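/- Let $(\mathbf R,\le)$ be an ordered field and let $\mathbf C=\mathbf R[i]=\mathbf R[T]/(T^2+1)$, whose elements $x+iy$ are identified with the points $(x,y)\in\mathbf R^2$. Definitions. For $n\ge 1$, $\mathbf R$ satisfies $\mathrm{IVT}_n$ if for every $F\in\mathbf R[X]$ with $\deg F\le n$ and all $a<b$ in $\mathbf R$ with $F(a)F(b)<0$ there is $c\in\mathbf R$ with $a<c<b$ and $F(c)=0$. Let $P,Q\in\mathbf R[X]$. If $P,Q\neq 0$ and $x\in\mathbf R$, write $P=(X-x)^{\mu}\widetilde P$ and $Q=(X-x)^{\nu}\widetilde Q$ with $\widetilde P(x)\ne 0$, $\widetilde Q(x)\neq 0$, and for $\varepsilon\in\{+1,-1\}$ put $\mathrm{Ind}_x^{\varepsilon}(Q,P)=\frac12\,\varepsilon^{\mu-\nu}\,\mathrm{sign}\big(\widetilde Q(x)\widetilde P(x)\big)$ if $\mu>\nu$, and $\mathrm{Ind}_x^{\varepsilon}(Q,P)=0$ otherwise. Let $\mathrm{Ind}_x=\mathrm{Ind}_x^{+}-\mathrm{Ind}_x^{-}$. The Cauchy index of $(Q,P)$ from $a$ to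 $b$ is $$\mathrm{Ind}_a^b(Q,P)=\mathrm{Ind}_a^+(Q,P)+\sum_{x\in(a,b)}\mathrm{Ind}_x(Q,P)-\mathrm{Ind}_b^-(Q,P)$$ if $a<b$ and $P,Q\ne 0$ (only the roots $x$ of $P$ contribute to the sum), it is $-\mathrm{Ind}_b^a(Q,P)$ if $a>b$ and $P,Q\neq 0$, and it is $0$ in every other case. Let $x_0<x_1$ and $y_0<y_1$ in $\mathbf R$, and let $\Gamma=[x_0,x_1]\times[y_0,y_1]\subset\mathbf R^2$, with boundary $\partial\Gamma$ the union of its four sides and interior $(x_0,x_1)\times(y_0,y_1)$. For $F\in\mathbf C[Z]$ let $F_{\mathrm{re}},F_{\mathrm{im}}\in\mathbf R[X,Y]$ be the polynomials with $F(X+iY)=F_{\mathrm{re}}(X,Y)+iF_{\mathrm{im}}(X,Y)$. The winding number of $F$ on $\partial\Gamma$ is $$\begin{aligned}w(F\,|\,\partial\Gamma)=\tfrac12\Big(&\mathrm{Ind}_{x_0}^{x_1}\big(F_{\mathrm{re}}(X,y_0),F_{\mathrm{im}}(X,y_0)\big)+\mathrm{Ind}_{y_0}^{y_1}\big(F_{\mathrm{re}}(x_1,Y),F_{\mathrm{im}}(x_1,Y)\big)\\&+\mathrm{Ind}_{x_1}^{x_0}\big(F_{\mathrm{re}}(X,y_1),F_{\mathrm{im}}(X,y_1)\big)+\mathrm{Ind}_{y_1}^{y_0}\big(F_{\mathrm{re}}(x_0,Y),F_{\mathrm{im}}(x_0,Y)\big)\Big).\end{aligned}$$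 Theorem. Let $d\ge 1$ be an integer and suppose that $\mathbf R$ satisfies $\mathrm{IVT}_{d^2}$. Let $\Gamma$ be a rectangle as above and let $F\in\mathbf C[Z]$ with $\deg F\le d$ have no zero on $\partial\Gamma$. Then $w(F\,|\,\partial\Gamma)$ equals the number of zeros of $F$ in the interior of $\Gamma$, counted with multiplicity. -/

import Mathlib

open Polynomial

noncomputable section

namespace WindingCount

/-- The intermediate value property for polynomials of degree at most `n` over an ordered field. -/
def IVT (R : Type*) [Field R] [LinearOrder R] (n : ℕ) : Prop :=
  ∀ F : R[X], F.natDegree ≤ n → ∀ a b : R, a < b → F.eval a * F.eval b < 0 →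
    ∃ c : R, a < c ∧ c < b ∧ F.eval c = 0

/-- The extension `R[i] = R[T]/(T² + 1)`; its elements are the pairs `⟨re, im⟩`. -/
abbrev Cpx (R : Type*) [Field R] : Type _ := QuadraticAlgebra R (-1) 0

/-- `-1` is not a square in an ordered field. -/
theorem fact_neg_one_not_square (R : Type*) [Field R] [LinearOrder R] [IsStrictOrderedRing R] :
    Fact (∀ r : R, r ^ 2 ≠ -1 + 0 * r) :=
  ⟨fun r h => by nlinarith [sq_nonneg r]⟩

/-- `R[i]` is a field, in particular a domain. -/
instance (R : Type*) [Field R] [LinearOrder R] [IsStrictOrderedRing R] : IsDomain (Cpx R) :=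
  haveI := fact_neg_one_not_square R
  (inferInstance : IsDomain (QuadraticAlgebra R (-1) 0))

section CauchyIndex

variable {R : Type*} [Field R] [LinearOrder R]

/-- The cofactor `P̃` in `P = (X - x)^μ P̃`, where `μ` is the multiplicity of `x` as a root of `P`
(for `P ≠ 0`, one has `P̃(x) ≠ 0`). -/
def cofactor (x : R) (P : R[X]) : R[X] :=
  P /ₘ (X - C x) ^ P.rootMultiplicity x

/-- The one-sided index `Ind_x^ε(Q, P)`, for `ε = 1` (right) or `ε = -1` (left). With `μ` and `ν`
the multiplicities of `x` as a root of `P` and `Q`, it is `½ ε^(μ-ν) sign(Q̃(x) P̃(x))` if `P` and `Q`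
are nonzero and `μ > ν`, and `0` otherwise. -/
def indSide (ε : ℤˣ) (x : R) (Q P : R[X]) : ℚ :=
  if P ≠ 0 ∧ Q ≠ 0 ∧ Q.rootMultiplicity x < P.rootMultiplicity x then
    (1 / 2 : ℚ) * ((ε : ℤ) : ℚ) ^ (P.rootMultiplicity x - Q.rootMultiplicity x) *
      ((SignType.sign ((cofactor x Q).eval x * (cofactor x P).eval x) : SignType) : ℚ)
  else 0

/-- The Cauchy index of `(Q, P)` at the point `x`. -/
def indAt (x : R) (Q P : R[X]) : ℚ :=
  indSide 1 x Q P - indSide (-1) x Q P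

/-- Only roots of `P` have a nonzero index. -/
theorem indAt_eq_zero (x : R) (Q P : R[X]) (h : ¬ P.IsRoot x) : indAt x Q P = 0 := by
  simp [indAt, indSide, rootMultiplicity_eq_zero h]

/-- The Cauchy index of `(Q, P)` on `[a, b]` when `a < b` and `P, Q ≠ 0`. The sum over all points
of `(a, b)` is written as a sum over the roots of `P` in `(a, b)`, the others contributing `0`. -/
def indIncreasing (a b : R) (Q P : R[X]) : ℚ :=
  indSide 1 a Q P + (∑ x ∈ P.roots.toFinset with a < x ∧ x < b, indAt x Q P)
    - indSide (-1) b Q P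

/-- The Cauchy index `Ind_a^b(Q, P)`, for arbitrary `a`, `b`, `Q`, `P`. -/
def cauchyIndex (a b : R) (Q P : R[X]) : ℚ :=
  if P ≠ 0 ∧ Q ≠ 0 ∧ a < b then indIncreasing a b Q P
  else if P ≠ 0 ∧ Q ≠ 0 ∧ b < a then -indIncreasing b a Q P
  else 0

end CauchyIndex

section Bivariate

variable {R : Type*} [Field R]

/-- The real part of a polynomial in `R[i][X, Y]`, taken coefficient by coefficient. -/
def rePart (F : MvPolynomial (Fin 2) (Cpx R)) : MvPolynomial (Fin 2) R :=
  ∑ m ∈ F.support, MvPolynomial.monomial m (F.coeff m).re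

/-- The imaginary part of a polynomial in `R[i][X, Y]`, taken coefficient by coefficient. -/
def imPart (F : MvPolynomial (Fin 2) (Cpx R)) : MvPolynomial (Fin 2) R :=
  ∑ m ∈ F.support, MvPolynomial.monomial m (F.coeff m).im

/-- The bivariate polynomial `F(X + iY)` attached to `F ∈ R[i][Z]`. -/
def toBivariate (F : (Cpx R)[X]) : MvPolynomial (Fin 2) (Cpx R) :=
  aeval (MvPolynomial.X 0 + MvPolynomial.C (QuadraticAlgebra.omega : Cpx R) * MvPolynomial.X 1) F

/-- The restriction `P(X, y) ∈ R[X]` of `P ∈ R[X, Y]` to a horizontal line. -/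
def alongX (y : R) (P : MvPolynomial (Fin 2) R) : R[X] :=
  MvPolynomial.aeval ![X, C y] P

/-- The restriction `P(x, Y) ∈ R[Y]` of `P ∈ R[X, Y]` to a vertical line. -/
def alongY (x : R) (P : MvPolynomial (Fin 2) R) : R[X] :=
  MvPolynomial.aeval ![C x, X] P

end Bivariate

section Winding

variable {R : Type*} [Field R] [LinearOrder R]

/-- The winding number of `F ∈ R[i][X, Y]` on the boundary of `[x₀, x₁] × [y₀, y₁]`, traversed
counterclockwise. -/
def windingNumber₂ (F : MvPolynomial (Fin 2) (Cpx R)) (x₀ x₁ y₀ y₁ : R) : ℚ :=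
  (1 / 2 : ℚ) *
    (cauchyIndex x₀ x₁ (alongX y₀ (rePart F)) (alongX y₀ (imPart F))
      + cauchyIndex y₀ y₁ (alongY x₁ (rePart F)) (alongY x₁ (imPart F))
      + cauchyIndex x₁ x₀ (alongX y₁ (rePart F)) (alongX y₁ (imPart F))
      + cauchyIndex y₁ y₀ (alongY x₀ (rePart F)) (alongY x₀ (imPart F)))

/-- The winding number of `F ∈ R[i][Z]` is that of `F(X + iY)`. -/
def windingNumber (F : (Cpx R)[X]) (x₀ x₁ y₀ y₁ : R) : ℚ :=
  windingNumber₂ (toBivariate F) x₀ x₁ y₀ y₁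

/-- The interior of the rectangle `[x₀, x₁] × [y₀, y₁]`, as a subset of `R[i]`. -/
def rectInterior (x₀ x₁ y₀ y₁ : R) : Set (Cpx R) :=
  {z | x₀ < z.re ∧ z.re < x₁ ∧ y₀ < z.im ∧ z.im < y₁}

/-- The boundary of the rectangle `[x₀, x₁] × [y₀, y₁]`: the union of its four sides. -/
def rectBoundary (x₀ x₁ y₀ y₁ : R) : Set (Cpx R) :=
  {z | (x₀ ≤ z.re ∧ z.re ≤ x₁ ∧ (z.im = y₀ ∨ z.im = y₁)) ∨
       (y₀ ≤ z.im ∧ z.im ≤ y₁ ∧ (z.re = x₀ ∨ z.re = x₁))}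

open Classical in
/-- The number of zeros of `F` in `S`, counted with multiplicity (for `F ≠ 0`). -/
def zeroCount [IsStrictOrderedRing R] (F : (Cpx R)[X]) (S : Set (Cpx R)) : ℕ :=
  Multiset.card (F.roots.filter (fun z => z ∈ S))

end Winding

end WindingCount

end

/-! Two facts give the count: F splits into linear factors over R[i], and the winding number is
additive on products. A constant has winding number 0, and `X - C z` has 1 or 0 according to whether
z lies inside or outside Γ, so induction on the degree concludes.

Splitting (`IVT.exists_eval_eq_zero`). R embeds in an ordered algebraic extension L with L[i]
algebraically closed. Here L is a subfield of the algebraic closure, maximal among those in which -1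
is not a sum of squares with nonnegative weights from R; the weights make the order of L extend that
of R. A zero ζ of F in L[i] and its complex conjugate, a zero of the conjugate polynomial, have
degree at most d over R[i]. Hence Re ζ and Im ζ have degree at most d² over R[i], and they are zeros
of nonzero polynomials over R of degree at most d². `IVT.exists_algebraMap_eq` isolates such a zero
between elements of R, found among zeros of the derivative, and the intermediate value property then
places it in R. Only this half needs d².

Additivity (`cauchyIndex_mul`, `windingNumber_mul`). Here degree d suffices. On a segment, the index
of a product is the sum of the indices plus a term depending only on signs of imaginary parts at the
two endpoints. The source is the identity sgn(u+v) - sgn u - sgn v = -sgn u · sgn v · sgn(u+v).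
Around the rectangle the corner terms cancel. -/

noncomputable section

namespace WindingCount

set_option linter.unusedSectionVars false

section FieldStructure

attribute [local instance] fact_neg_one_not_square

/-! ### Artin's criterion for algebraic closedness -/

section RealClosed

/-- A field in which every element is a square has no quadratic extension. -/
theorem finrank_ne_two_of_sq {k E : Type*} [Field k] [CharZero k] [Field E] [Algebra k E]
    (sq : ∀ z : k, IsSquare z) (M : IntermediateField k E) : Module.finrank k M ≠ 2 := by
  intro hM
  have : FiniteDimensional k M := Module.finite_of_finrank_pos (by omega)
  have hlt : ∃ y ∈ M, y ∉ (⊥ : IntermediateField k E) := by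
    by_contra! h
    have : M = ⊥ := le_bot_iff.1 h
    rw [this, IntermediateField.finrank_bot] at hM
    omega
  obtain ⟨y, hy, hy'⟩ := hlt
  apply hy'
  set z : M := ⟨y, hy⟩
  have hint : IsIntegral k z := IsIntegral.of_finite k z
  have hdeg : (minpoly k z).natDegree ≤ 2 := hM ▸ minpoly.natDegree_le z
  have hy0 : (minpoly k z).natDegree ≠ 1 := by
    intro h1
    obtain ⟨c, hc⟩ := minpoly.mem_range_of_degree_eq_one k z
      (by rw [degree_eq_natDegree (minpoly.ne_zero hint), h1]; rfl)
    exact hy' (IntermediateField.mem_bot.2 ⟨c, by simpa [z] using congrArg Subtype.val hc⟩)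
  have hpos := minpoly.natDegree_pos hint
  have h2 : (minpoly k z).natDegree = 2 := by omega
  have hmon := minpoly.monic hint
  set m := minpoly k z with hm
  have hexp : m = X ^ 2 + C (m.coeff 1) * X + C (m.coeff 0) := by
    conv_lhs => rw [hmon.as_sum, h2]
    simp [Finset.sum_range_succ]
    ring
  -- Completing the square: `w` is a square root of a quarter of the discriminant.
  obtain ⟨w, hw⟩ := sq ((m.coeff 1) ^ 2 / 4 - m.coeff 0)
  have hfac : m = (X - C (w - m.coeff 1 / 2)) * (X - C (-w - m.coeff 1 / 2)) := by
    have e : m.coeff 0 = (w - m.coeff 1 / 2) * (-w - m.coeff 1 / 2) := by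
      linear_combination -hw
    conv_lhs => rw [hexp, e]
    have e2 : m.coeff 1 = -((w - m.coeff 1 / 2) + (-w - m.coeff 1 / 2)) := by ring
    conv_lhs => rw [e2]
    simp only [C_mul, C_neg, C_add]
    rw [← e2]
    ring
  have hirr : Irreducible m := minpoly.irreducible hint
  rcases hirr.isUnit_or_isUnit hfac with h | h <;> exact absurd h (not_isUnit_X_sub_C _)

-- The fixed field of a Sylow 2-subgroup has odd degree over L. The minimal polynomial of a
-- primitive element then has a root in L, so this degree is 1 and the Galois group is a 2-group. If
-- Gal(E/C) were nontrivial it would have a subgroup of index 2, whose fixed field would be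
-- quadratic over C.
open IntermediateField in
theorem finrank_eq_one_of_sq_of_odd {L C E : Type*} [Field L] [CharZero L] [Field C] [Field E]
    [Algebra L C] [Algebra C E] [Algebra L E] [IsScalarTower L C E]
    (hLC : Module.finrank L C = 2)
    (odd : ∀ f : L[X], Odd f.natDegree → ∃ x, f.IsRoot x) (sq : ∀ z : C, IsSquare z)
    [FiniteDimensional L E] [IsGalois L E] : Module.finrank C E = 1 := by
  have : FiniteDimensional C E := FiniteDimensional.right L C E
  have : IsGalois C E := IsGalois.tower_top_of_isGalois L C E
  have : CharZero C := charZero_of_injective_algebraMap (algebraMap L C).injective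
  have hmul : 2 * Module.finrank C E = Module.finrank L E := by
    rw [← hLC]; exact Module.finrank_mul_finrank L C E
  have : Fact (Nat.Prime 2) := ⟨Nat.prime_two⟩
  obtain ⟨P⟩ : Nonempty (Sylow 2 Gal(E/L)) := inferInstance
  have hPodd : Module.finrank L (fixedField (P : Subgroup Gal(E/L))) = 1 := by
    set F := fixedField (P : Subgroup Gal(E/L))
    have h1 : Module.finrank F E = Nat.card P := finrank_fixedField_eq_card _
    have h2 : Module.finrank L F * Module.finrank F E = Module.finrank L E :=
      Module.finrank_mul_finrank L F E
    have h3 : Nat.card Gal(E/L) = Module.finrank L E := IsGalois.card_aut_eq_finrank L E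
    have h4 := (P : Subgroup Gal(E/L)).index_mul_card
    have h5 : (P : Subgroup Gal(E/L)).index = Module.finrank L F := by
      rw [h3, ← h2, h1] at h4
      exact Nat.eq_of_mul_eq_mul_right Nat.card_pos h4
    have h6 : Odd (Module.finrank L F) := by
      rw [← h5, ← Nat.not_even_iff_odd, even_iff_two_dvd]
      exact P.not_dvd_index
    obtain ⟨α, hα⟩ := Field.exists_primitive_element L F
    have hint : IsIntegral L α := IsIntegral.of_finite L α
    have h7 : (minpoly L α).natDegree = Module.finrank L F := by
      rw [← IntermediateField.adjoin.finrank hint, hα, IntermediateField.finrank_top']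
    obtain ⟨x, hx⟩ := odd (minpoly L α) (h7 ▸ h6)
    rw [← h7]
    exact natDegree_eq_of_degree_eq_some
      (degree_eq_one_of_irreducible_of_root (minpoly.irreducible hint) hx)
  have hpow : ∃ k, Module.finrank L E = 2 ^ k := by
    refine ⟨(Nat.card Gal(E/L)).factorization 2, ?_⟩
    rw [← P.card_eq_multiplicity, ← finrank_fixedField_eq_card,
      ← Module.finrank_mul_finrank L (fixedField (P : Subgroup Gal(E/L))) E, hPodd, one_mul]
  obtain ⟨k, hk⟩ := hpow
  obtain ⟨j, hj⟩ : ∃ j, Module.finrank C E = 2 ^ j := by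
    rcases k with _ | k
    · omega
    · exact ⟨k, by rw [pow_succ] at hk; omega⟩
  rcases j with _ | j
  · simpa using hj
  exfalso
  have hcard : Nat.card Gal(E/C) = 2 ^ (j + 1) := by rw [IsGalois.card_aut_eq_finrank, hj]
  obtain ⟨H, hH⟩ := Sylow.exists_subgroup_card_pow_prime (G := Gal(E/C)) 2 (n := j)
    (by rw [hcard]; exact pow_dvd_pow _ (by omega))
  apply finrank_ne_two_of_sq sq (fixedField H)
  have h1 : Module.finrank (fixedField H) E = 2 ^ j := by rw [finrank_fixedField_eq_card, hH]
  have h2 := Module.finrank_mul_finrank C (fixedField H) E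
  rw [h1, hj, pow_succ, mul_comm] at h2
  exact Nat.eq_of_mul_eq_mul_left (by positivity) h2

theorem isAlgClosed_of_sq_of_odd {L C : Type*} [Field L] [CharZero L] [Field C] [Algebra L C]
    (hLC : Module.finrank L C = 2)
    (odd : ∀ f : L[X], Odd f.natDegree → ∃ x, f.IsRoot x) (sq : ∀ z : C, IsSquare z) :
    IsAlgClosed C := by
  refine IsAlgClosed.of_exists_root C fun p hp hirr => ?_
  have := Fact.mk hirr
  have : FiniteDimensional L C := Module.finite_of_finrank_pos (by omega)
  let K := AdjoinRoot p
  have : FiniteDimensional C K := (AdjoinRoot.powerBasis hirr.ne_zero).finite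
  have : FiniteDimensional L K := FiniteDimensional.trans L C K
  let A := AlgebraicClosure K
  have : Algebra.IsAlgebraic L A := Algebra.IsAlgebraic.trans L K A
  have : Normal L A := IsAlgClosure.normal L A
  let N := IntermediateField.normalClosure L K A
  -- The root field K need not be normal over L. C acts on the normal closure N through K, so that
  -- the root of `p` in K can be compared with an element of C inside N.
  let g : C →+* N := (algebraMap K N).comp (algebraMap C K)
  let : Algebra C N := g.toAlgebra
  have : IsScalarTower L C N := IsScalarTower.of_algebraMap_eq fun x => by
    change _ = algebraMap K N (algebraMap C K (algebraMap L C x))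
    rw [← IsScalarTower.algebraMap_apply L C K, ← IsScalarTower.algebraMap_apply L K N]
  have : IsGalois L N := ⟨⟩
  have h1 : Module.finrank C N = 1 := finrank_eq_one_of_sq_of_odd hLC odd sq
  obtain ⟨c, hc⟩ : algebraMap K N (AdjoinRoot.root p) ∈ (⊥ : IntermediateField C N) := by
    rw [IntermediateField.bot_eq_top_iff_finrank_eq_one.2 h1]
    trivial
  refine ⟨c, ?_⟩
  have h2 : algebraMap K N (AdjoinRoot.of p c) = algebraMap K N (AdjoinRoot.root p) := hc
  have h3 := (algebraMap K N).injective h2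
  have h4 := AdjoinRoot.eval₂_root p
  rw [← h3, eval₂_at_apply] at h4
  exact (map_eq_zero _).1 h4

/-- With n = |z|, a root is a + ib where a² = (n + Re z)/2 and b² = (n - Re z)/2. Then 2ab = ± Im z,
and the sign of b is chosen accordingly. -/
theorem isSquare_cpx {L : Type*} [Field L] [LinearOrder L] [IsStrictOrderedRing L]
    (sq : ∀ x : L, 0 ≤ x → IsSquare x) (z : Cpx L) : IsSquare z := by
  obtain ⟨n, hn⟩ := sq (z.re * z.re + z.im * z.im)
    (add_nonneg (mul_self_nonneg _) (mul_self_nonneg _))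
  wlog hn0 : 0 ≤ n generalizing n
  · exact this (-n) (by rw [hn]; ring) (by linarith)
  have hre : |z.re| ≤ n := abs_le_of_sq_le_sq (by nlinarith) hn0
  have h1 := abs_le.1 hre
  obtain ⟨a, ha⟩ := sq ((n + z.re) / 2) (by linarith)
  obtain ⟨b, hb⟩ := sq ((n - z.re) / 2) (by linarith)
  have hab : (2 * a * b) ^ 2 = z.im ^ 2 := by
    calc (2 * a * b) ^ 2 = 4 * (a * a) * (b * b) := by ring
      _ = _ := by rw [← ha, ← hb]; linear_combination -hn
  have hsub : a * a - b * b = z.re := by linear_combination hb - ha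
  rcases sq_eq_sq_iff_eq_or_eq_neg.1 hab with h | h
  · refine ⟨⟨a, b⟩, ?_⟩
    ext
    · simp; linear_combination -hsub
    · simp; linear_combination -h
  · refine ⟨⟨a, -b⟩, ?_⟩
    ext
    · simp; linear_combination -hsub
    · simp; linear_combination h

theorem isAlgClosed_cpx {L : Type*} [Field L] [LinearOrder L] [IsStrictOrderedRing L]
    (sq : ∀ x : L, 0 ≤ x → IsSquare x)
    (odd : ∀ f : L[X], Odd f.natDegree → ∃ x, f.IsRoot x) : IsAlgClosed (Cpx L) :=
  isAlgClosed_of_sq_of_odd (L := L) (QuadraticAlgebra.finrank_eq_two _ _) odd (isSquare_cpx sq)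

end RealClosed

/-! ### Sums of squares modulo a polynomial of odd degree -/

section EvenPos

variable {L : Type*} [Field L] [LinearOrder L] [IsStrictOrderedRing L]

/-- The zero polynomial and the polynomials of even degree with positive leading coefficient. -/
def EvenPos (S : L[X]) : Prop := S = 0 ∨ (Even S.natDegree ∧ 0 < S.leadingCoeff)

theorem EvenPos.add {S T : L[X]} (hS : EvenPos S) (hT : EvenPos T) :
    EvenPos (S + T) ∧ (S + T).natDegree = max S.natDegree T.natDegree := by
  rcases hS with rfl | ⟨hS, hS'⟩
  · simpa using hT
  rcases hT with rfl | ⟨hT, hT'⟩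
  · rw [add_zero, natDegree_zero]
    exact ⟨Or.inr ⟨hS, hS'⟩, by simp⟩
  rcases lt_trichotomy S.natDegree T.natDegree with h | h | h
  · have h1 := natDegree_add_eq_right_of_natDegree_lt h
    refine ⟨Or.inr ⟨by rwa [h1], ?_⟩, by rw [h1, max_eq_right h.le]⟩
    rwa [leadingCoeff_add_of_degree_lt (degree_lt_degree h)]
  · have h0 : (S + T).coeff S.natDegree = S.leadingCoeff + T.leadingCoeff := by
      rw [coeff_add, leadingCoeff, leadingCoeff, h]
    have hpos : 0 < (S + T).coeff S.natDegree := by rw [h0]; positivity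
    have h1 : (S + T).natDegree = S.natDegree := by
      refine le_antisymm ((natDegree_add_le _ _).trans (by rw [h, max_self])) ?_
      exact le_natDegree_of_ne_zero hpos.ne'
    refine ⟨Or.inr ⟨by rwa [h1], ?_⟩, by rw [h1, h, max_self]⟩
    rwa [leadingCoeff, h1]
  · have h1 := natDegree_add_eq_left_of_natDegree_lt h
    refine ⟨Or.inr ⟨by rwa [h1], ?_⟩, by rw [h1, max_eq_left h.le]⟩
    rwa [leadingCoeff_add_of_degree_lt' (degree_lt_degree h)]

theorem EvenPos.mul_self (g : L[X]) : EvenPos (g * g) := by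
  by_cases h : g = 0
  · exact Or.inl (by simp [h])
  · refine Or.inr ⟨⟨g.natDegree, natDegree_mul h h⟩, ?_⟩
    rw [leadingCoeff_mul]
    exact mul_self_pos.2 (leadingCoeff_ne_zero.2 h)

theorem EvenPos.one : EvenPos (1 : L[X]) := by simpa using EvenPos.mul_self (1 : L[X])

/-- Each summand is replaced by the square of its remainder modulo `f`. Leading coefficients of
nonzero squares are positive, so nothing cancels at the top and the degree of the sum stays even. -/
theorem exists_isSumSq_natDegree_le {f : L[X]} (hf : 0 < f.natDegree) {S : L[X]}
    (hS : IsSumSq S) :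
    ∃ T, IsSumSq T ∧ EvenPos T ∧ T.natDegree ≤ 2 * (f.natDegree - 1) ∧ f ∣ S - T := by
  induction hS with
  | zero => exact ⟨0, .zero, Or.inl rfl, by simp, by simp⟩
  | sq_add g _ ih =>
    obtain ⟨T, h1, h2, h3, h4⟩ := ih
    have hlt : (g % f).natDegree < f.natDegree := natDegree_mod_lt g hf.ne'
    obtain ⟨h5, h6⟩ := (EvenPos.mul_self (g % f)).add h2
    refine ⟨(g % f) * (g % f) + T, .sq_add _ h1, h5, ?_, ?_⟩
    · rw [h6]
      refine max_le (natDegree_mul_le.trans (by omega)) h3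
    · have h7 : f ∣ g - g % f := ⟨g / f, by
        linear_combination -(EuclideanDomain.div_add_mod g f)⟩
      have := dvd_add (h7.mul_right (g + g % f)) h4
      convert this using 1
      ring

/-- Descent on the degree. After reduction, f·h = 1 + T with an even degree at most 2(deg f - 1).
The cofactor h therefore has odd degree smaller than deg f, and it also divides 1 + T. -/
theorem not_dvd_one_add_isSumSq {f : L[X]} (hf : Odd f.natDegree) {S : L[X]} (hS : IsSumSq S) :
    ¬ f ∣ 1 + S := by
  induction hn : f.natDegree using Nat.strong_induction_on generalizing f S with
  | _ n ih =>
    intro hdvd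
    obtain ⟨T, h1, h2, h3, h4⟩ := exists_isSumSq_natDegree_le hf.pos hS
    obtain ⟨h, hh⟩ : f ∣ 1 + T := by
      have := dvd_sub hdvd h4
      convert this using 1
      ring
    obtain ⟨h5, h6⟩ := EvenPos.one.add h2
    rw [natDegree_one, Nat.zero_max] at h6
    have hne : 1 + T ≠ 0 := by
      intro h0
      rcases h2 with rfl | ⟨_, h2⟩
      · simp at h0
      · have : T = -1 := by linear_combination h0
        rw [this, leadingCoeff_neg, leadingCoeff_one] at h2
        linarith
    have h7 : Even (1 + T).natDegree := by
      rcases h5 with h5 | h5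
      · exact absurd h5 hne
      · exact h5.1
    have h8 : f.natDegree + h.natDegree = (1 + T).natDegree := by
      rw [hh] at hne ⊢
      rw [natDegree_mul (left_ne_zero_of_mul hne) (right_ne_zero_of_mul hne)]
    have h9 : Odd h.natDegree := by
      rw [← h8, Nat.even_add] at h7
      rw [← Nat.not_even_iff_odd] at hf ⊢
      tauto
    exact ih h.natDegree (by have := hf.pos; omega) h9 h1 rfl ⟨f, by rw [hh, mul_comm]⟩

end EvenPos

/-! ### A maximal real subfield and its ordering -/

section RealClosure

variable {R K : Type*} [Field R] [LinearOrder R] [IsStrictOrderedRing R] [Field K] [Algebra R K]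

/-- The sums of the squares of elements of `M`, with nonnegative weights from `R`. -/
def weightedSquares (M : IntermediateField R K) : AddSubmonoid K :=
  AddSubmonoid.closure {y | ∃ r : R, 0 ≤ r ∧ ∃ z ∈ M, y = algebraMap R K r * z ^ 2}

theorem mem_weightedSquares {M : IntermediateField R K} {r : R} (hr : 0 ≤ r) {z : K} (hz : z ∈ M) :
    algebraMap R K r * z ^ 2 ∈ weightedSquares M :=
  AddSubmonoid.subset_closure ⟨r, hr, z, hz, rfl⟩

theorem sq_mem_weightedSquares {M : IntermediateField R K} {z : K} (hz : z ∈ M) :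
    z ^ 2 ∈ weightedSquares M := by
  simpa using mem_weightedSquares (R := R) zero_le_one hz

theorem one_mem_weightedSquares (M : IntermediateField R K) : 1 ∈ weightedSquares M := by
  simpa using sq_mem_weightedSquares M.one_mem

theorem weightedSquares_le {M : IntermediateField R K} {y : K} (hy : y ∈ weightedSquares M) :
    y ∈ M := by
  induction hy using AddSubmonoid.closure_induction with
  | mem y hy =>
    obtain ⟨r, -, z, hz, rfl⟩ := hy
    exact mul_mem (M.algebraMap_mem r) (pow_mem hz 2)
  | zero => exact zero_mem _
  | add _ _ _ _ h h' => exact add_mem h h'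

theorem weightedSquares_mono {M N : IntermediateField R K} (h : M ≤ N) :
    weightedSquares M ≤ weightedSquares N :=
  AddSubmonoid.closure_mono fun _ ⟨r, hr, z, hz, e⟩ => ⟨r, hr, z, h hz, e⟩

theorem mul_mem_weightedSquares {M : IntermediateField R K} {x y : K}
    (hx : x ∈ weightedSquares M) (hy : y ∈ weightedSquares M) : x * y ∈ weightedSquares M := by
  induction hx, hy using AddSubmonoid.closure_induction₂ with
  | mem x y hx hy =>
    obtain ⟨r, hr, z, hz, rfl⟩ := hx
    obtain ⟨s, hs, w, hw, rfl⟩ := hy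
    have := mem_weightedSquares (mul_nonneg hr hs) (mul_mem hz hw)
    convert this using 1
    rw [map_mul]; ring
  | zero_left => simp
  | zero_right => simp
  | add_left _ _ _ _ _ _ h h' => rw [add_mul]; exact add_mem h h'
  | add_right _ _ _ _ _ _ h h' => rw [mul_add]; exact add_mem h h'

/-- `-1` is not a weighted sum of squares in `M`. -/
def IsRealOver (M : IntermediateField R K) : Prop := (-1 : K) ∉ weightedSquares M

theorem isRealOver_bot : IsRealOver (⊥ : IntermediateField R K) := by
  intro h
  have key : ∀ y ∈ weightedSquares (⊥ : IntermediateField R K),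
      ∃ s : R, 0 ≤ s ∧ y = algebraMap R K s := by
    intro y hy
    induction hy using AddSubmonoid.closure_induction with
    | mem y hy =>
      obtain ⟨r, hr, z, hz, rfl⟩ := hy
      obtain ⟨t, rfl⟩ := IntermediateField.mem_bot.1 hz
      exact ⟨r * t ^ 2, by positivity, by simp⟩
    | zero => exact ⟨0, le_rfl, by simp⟩
    | add _ _ _ _ h h' =>
      obtain ⟨s, hs, rfl⟩ := h
      obtain ⟨t, ht, rfl⟩ := h'
      exact ⟨s + t, add_nonneg hs ht, by simp⟩
  obtain ⟨s, hs, e⟩ := key _ h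
  have : algebraMap R K (-1) = algebraMap R K s := by simpa using e
  have := (algebraMap R K).injective this
  linarith

-- Zorn's lemma applies because a weighted sum of squares involves finitely many elements, so one in
-- the union of a chain already lives in a member of the chain.
variable (R K) in
theorem exists_maximal_isRealOver : ∃ M : IntermediateField R K, Maximal IsRealOver M := by
  obtain ⟨M, -, hM⟩ := zorn_le_nonempty₀ {M : IntermediateField R K | IsRealOver M}
    (fun c hc hchain M₀ hM₀ => by
      refine ⟨sSup c, ?_, fun M hM => le_sSup hM⟩
      have : Nonempty c := ⟨⟨M₀, hM₀⟩⟩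
      have hdir : Directed (· ≤ ·) (fun M : c => (M : IntermediateField R K)) :=
        hchain.directedOn.directed_val
      have key : ∀ y ∈ weightedSquares (sSup c), ∃ M ∈ c, y ∈ weightedSquares M := by
        intro y hy
        induction hy using AddSubmonoid.closure_induction with
        | mem y hy =>
          obtain ⟨r, hr, z, hz, rfl⟩ := hy
          rw [sSup_eq_iSup', ← SetLike.mem_coe, IntermediateField.coe_iSup_of_directed hdir,
            Set.mem_iUnion] at hz
          obtain ⟨M, hM⟩ := hz
          exact ⟨M, M.2, mem_weightedSquares hr hM⟩
        | zero => exact ⟨M₀, hM₀, zero_mem _⟩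
        | add _ _ _ _ h h' =>
          obtain ⟨M, hM, h⟩ := h
          obtain ⟨N, hN, h'⟩ := h'
          rcases hchain.total hM hN with hle | hle
          · exact ⟨N, hN, add_mem (weightedSquares_mono hle h) h'⟩
          · exact ⟨M, hM, add_mem h (weightedSquares_mono hle h')⟩
      intro h
      obtain ⟨M, hM, h⟩ := key _ h
      exact hc hM h) ⊥ isRealOver_bot
  exact ⟨M, hM⟩

theorem mem_of_maximal_of_isRealOver {M : IntermediateField R K} (hM : Maximal IsRealOver M) {s : K}
    (h : IsRealOver ((IntermediateField.adjoin M {s}).restrictScalars R)) : s ∈ M := by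
  have hle : M ≤ (IntermediateField.adjoin M {s}).restrictScalars R := fun x hx =>
    (IntermediateField.adjoin M {s}).algebraMap_mem ⟨x, hx⟩
  exact hM.2 h hle (IntermediateField.mem_adjoin_simple_self M s)

theorem exists_aeval_eq_of_mem_adjoin {F : Type*} [Field F] [Algebra F K] {s z : K}
    (hs : IsAlgebraic F s) (hz : z ∈ IntermediateField.adjoin F {s}) :
    ∃ g : F[X], aeval s g = z := by
  rw [← IntermediateField.mem_toSubalgebra,
    IntermediateField.adjoin_simple_toSubalgebra_of_isAlgebraic hs,
    Algebra.adjoin_singleton_eq_range_aeval] at hz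
  exact hz

/-- If s = √x were outside M, maximality would give -1 = A + xB + cs with A, B weighted sums of
squares and c in M. If c ≠ 0, then s lies in M. If c = B = 0, then M is not real. Otherwise -x = (1
+ A)·B·(B⁻¹)² is a weighted sum of squares. -/
theorem exists_sq_eq_of_maximal [IsAlgClosed K] {M : IntermediateField R K}
    (hM : Maximal IsRealOver M) {x : K} (hx : x ∈ M) (hneg : -x ∉ weightedSquares M) :
    ∃ s ∈ M, s ^ 2 = x := by
  obtain ⟨s, hs⟩ := IsAlgClosed.exists_pow_nat_eq x (n := 2) (by norm_num)
  refine ⟨s, ?_, hs⟩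
  by_contra hsM
  have halg : IsAlgebraic M s := by
    refine ⟨X ^ 2 - C ⟨x, hx⟩, (monic_X_pow_sub_C _ two_ne_zero).ne_zero, ?_⟩
    rw [map_sub, map_pow, aeval_X, aeval_C, hs]
    exact sub_self x
  have hlin : ∀ g : M[X], ∃ a b : M, aeval s g = a + b * s := by
    intro g
    induction g using Polynomial.induction_on with
    | C a => exact ⟨a, 0, by rw [aeval_C]; simp⟩
    | add p q hp hq =>
      obtain ⟨a, b, h⟩ := hp
      obtain ⟨a', b', h'⟩ := hq
      exact ⟨a + a', b + b', by rw [map_add, h, h']; push_cast; ring⟩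
    | monomial n c h =>
      obtain ⟨a, b, h⟩ := h
      refine ⟨b * ⟨x, hx⟩, a, ?_⟩
      rw [pow_succ, ← mul_assoc, map_mul, h, aeval_X]
      push_cast
      rw [← hs]; ring
  refine hsM (mem_of_maximal_of_isRealOver hM fun h => ?_)
  have key : ∀ y ∈ weightedSquares ((IntermediateField.adjoin M {s}).restrictScalars R),
      ∃ A ∈ weightedSquares M, ∃ B ∈ weightedSquares M, ∃ c ∈ M, y = A + x * B + c * s := by
    intro y hy
    induction hy using AddSubmonoid.closure_induction with
    | mem y hy =>
      obtain ⟨r, hr, z, hz, rfl⟩ := hy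
      obtain ⟨g, hg⟩ := exists_aeval_eq_of_mem_adjoin halg hz
      obtain ⟨a, b, hab⟩ := hlin g
      rw [← hg, hab]
      refine ⟨_, mem_weightedSquares hr a.2, _, mem_weightedSquares hr b.2,
        algebraMap R K r * 2 * (a * b), mul_mem (mul_mem (M.algebraMap_mem r) (ofNat_mem M 2))
          (mul_mem a.2 b.2), ?_⟩
      rw [← hs]; ring
    | zero => exact ⟨0, zero_mem _, 0, zero_mem _, 0, zero_mem _, by simp⟩
    | add _ _ _ _ h h' =>
      obtain ⟨A, hA, B, hB, c, hc, rfl⟩ := h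
      obtain ⟨A', hA', B', hB', c', hc', rfl⟩ := h'
      exact ⟨A + A', add_mem hA hA', B + B', add_mem hB hB', c + c', add_mem hc hc', by ring⟩
  obtain ⟨A, hA, B, hB, c, hc, e⟩ := key _ h
  have hAM := weightedSquares_le hA
  have hBM := weightedSquares_le hB
  by_cases hc0 : c = 0
  · by_cases hB0 : B = 0
    · apply hM.1
      convert hA using 1
      rw [e, hc0, hB0]; ring
    · apply hneg
      have := mul_mem_weightedSquares (mul_mem_weightedSquares
        (add_mem (one_mem_weightedSquares M) hA) hB) (sq_mem_weightedSquares (inv_mem hBM))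
      convert this using 1
      rw [hc0] at e
      field_simp
      linear_combination e
  · apply hsM
    have : s = (-1 - A - x * B) / c := by
      field_simp
      linear_combination -e
    rw [this]
    exact div_mem (sub_mem (sub_mem (neg_mem (one_mem M)) hAM) (mul_mem hx hBM)) hc

/-- If x ≠ 0, then -1 = x·(-x)·(x⁻¹)² would be a weighted sum of squares. -/
theorem eq_zero_of_mem_of_neg_mem {M : IntermediateField R K} (hM : IsRealOver M) {x : K}
    (h : x ∈ weightedSquares M) (h' : -x ∈ weightedSquares M) : x = 0 := by
  by_contra hx
  apply hM
  have := mul_mem_weightedSquares (mul_mem_weightedSquares h h')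
    (sq_mem_weightedSquares (inv_mem (weightedSquares_le h)))
  convert this using 1
  field_simp

theorem exists_sq_eq_of_mem_weightedSquares [IsAlgClosed K] {M : IntermediateField R K}
    (hM : Maximal IsRealOver M) {x : K} (hx : x ∈ weightedSquares M) : ∃ s ∈ M, s ^ 2 = x := by
  by_cases h : -x ∈ weightedSquares M
  · exact ⟨0, zero_mem M, by rw [eq_zero_of_mem_of_neg_mem hM.1 hx h]; simp⟩
  · exact exists_sq_eq_of_maximal hM (weightedSquares_le hx) h

/-- The weighted sums of squares as a cone in `M`. -/
def squareCone {M : IntermediateField R K} (hM : IsRealOver M) : RingCone M where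
  carrier := {x | (x : K) ∈ weightedSquares M}
  add_mem' := fun h h' => (weightedSquares M).add_mem h h'
  zero_mem' := zero_mem (weightedSquares M)
  mul_mem' := fun h h' => mul_mem_weightedSquares h h'
  one_mem' := one_mem_weightedSquares M
  eq_zero_of_mem_of_neg_mem' := fun h h' => Subtype.ext (eq_zero_of_mem_of_neg_mem hM h h')

theorem mem_squareCone {M : IntermediateField R K} (hM : IsRealOver M) {x : M} :
    x ∈ squareCone hM ↔ (x : K) ∈ weightedSquares M := Iff.rfl

theorem hasMemOrNegMem_squareCone [IsAlgClosed K] {M : IntermediateField R K}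
    (hM : Maximal IsRealOver M) : HasMemOrNegMem (squareCone hM.1) where
  mem_or_neg_mem x := by
    by_cases h : -(x : K) ∈ weightedSquares M
    · exact Or.inr h
    · obtain ⟨s, hs, e⟩ := exists_sq_eq_of_maximal hM x.2 h
      left
      rw [mem_squareCone, ← e]
      exact sq_mem_weightedSquares hs

/-- For irreducible f with a root θ outside M, maximality makes -1 a weighted sum of squares in
M(θ). The weights are squares in M, so f divides 1 plus a sum of squares of polynomials, against
`not_dvd_one_add_isSumSq`. A reducible f has a factor of smaller odd degree. -/
theorem exists_isRoot_of_maximal [IsAlgClosed K] {M : IntermediateField R K}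
    (hM : Maximal IsRealOver M) [LinearOrder M] [IsStrictOrderedRing M]
    {f : M[X]} (hf : Odd f.natDegree) : ∃ x, f.IsRoot x := by
  induction hn : f.natDegree using Nat.strong_induction_on generalizing f with
  | _ n ih =>
  by_cases hirr : Irreducible f
  · obtain ⟨θ, hθ⟩ := IsAlgClosed.exists_aeval_eq_zero K f
      (by rw [degree_eq_natDegree hirr.ne_zero]; exact_mod_cast hf.pos.ne')
    have halg : IsAlgebraic M θ := ⟨f, hirr.ne_zero, hθ⟩
    have hθM : θ ∈ M := by
      refine mem_of_maximal_of_isRealOver hM fun h => ?_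
      have key : ∀ y ∈ weightedSquares ((IntermediateField.adjoin M {θ}).restrictScalars R),
          ∃ S : M[X], IsSumSq S ∧ aeval θ S = y := by
        intro y hy
        induction hy using AddSubmonoid.closure_induction with
        | mem y hy =>
          obtain ⟨r, hr, z, hz, rfl⟩ := hy
          obtain ⟨g, rfl⟩ := exists_aeval_eq_of_mem_adjoin halg hz
          have : algebraMap R K r ∈ weightedSquares M := by
            simpa using mem_weightedSquares hr (one_mem M)
          obtain ⟨s, hs, e⟩ := exists_sq_eq_of_mem_weightedSquares hM this
          refine ⟨(C ⟨s, hs⟩ * g) * (C ⟨s, hs⟩ * g), .mul_self _, ?_⟩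
          rw [map_mul, map_mul, aeval_C, ← e]
          change (s * _) * (s * _) = _
          ring
        | zero => exact ⟨0, .zero, by simp⟩
        | add _ _ _ _ h h' =>
          obtain ⟨S, hS, rfl⟩ := h
          obtain ⟨T, hT, rfl⟩ := h'
          exact ⟨S + T, hS.add hT, by simp⟩
      obtain ⟨S, hS, e⟩ := key _ h
      apply not_dvd_one_add_isSumSq hf hS
      have h1 : aeval θ (1 + S) = 0 := by rw [map_add, e]; simp
      have h2 : minpoly M θ ∣ f := minpoly.dvd _ _ hθ
      have h3 : f ∣ minpoly M θ := (hirr.dvd_iff.1 h2).resolve_left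
        (minpoly.not_isUnit M θ) |>.dvd
      exact h3.trans (minpoly.dvd _ _ h1)
    refine ⟨⟨θ, hθM⟩, ?_⟩
    have h4 : algebraMap M K (f.eval ⟨θ, hθM⟩) = 0 := by
      rw [← aeval_algebraMap_apply_eq_algebraMap_eval]; exact hθ
    exact (map_eq_zero _).1 h4
  · have hf0 : f ≠ 0 := by rintro rfl; simp at hf
    have hu : ¬ IsUnit f := fun h => by
      rw [natDegree_eq_zero_of_isUnit h] at hf; simp at hf
    obtain ⟨a, b, ha, hb, rfl⟩ : ∃ a b, ¬ IsUnit a ∧ ¬ IsUnit b ∧ f = a * b := by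
      by_contra! hcon
      refine hirr ⟨hu, fun a b hab => ?_⟩
      by_contra! h
      exact hcon a b h.1 h.2 hab
    have ha0 := left_ne_zero_of_mul hf0
    have hb0 := right_ne_zero_of_mul hf0
    have hda : 0 < a.natDegree :=
      natDegree_pos_iff_degree_pos.2 (degree_pos_of_ne_zero_of_nonunit ha0 ha)
    have hdb : 0 < b.natDegree :=
      natDegree_pos_iff_degree_pos.2 (degree_pos_of_ne_zero_of_nonunit hb0 hb)
    rw [natDegree_mul ha0 hb0] at hf hn
    rcases Nat.even_or_odd a.natDegree with h | h
    · have h' : Odd b.natDegree := by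
        rcases Nat.even_or_odd b.natDegree with h' | h'
        · exact absurd (h.add h') (Nat.not_even_iff_odd.2 hf)
        · exact h'
      obtain ⟨x, hx⟩ := ih _ (by omega) h' rfl
      exact ⟨x, root_mul_left_of_isRoot a hx⟩
    · obtain ⟨x, hx⟩ := ih _ (by omega) h rfl
      exact ⟨x, root_mul_right_of_isRoot b hx⟩

/-- Every ordered field `R` has an ordered algebraic extension `L` with `L[i]` algebraically
closed. -/
theorem exists_ordered_extension_isAlgClosed (R : Type*) [Field R] [LinearOrder R]
    [IsStrictOrderedRing R] :
    ∃ (M : IntermediateField R (AlgebraicClosure R)) (_ : LinearOrder M)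
      (_ : IsStrictOrderedRing M),
      StrictMono (algebraMap R M) ∧ (∀ x : M, 0 ≤ x → IsSquare x) ∧ IsAlgClosed (Cpx M) := by
  classical
  obtain ⟨M, hM⟩ := exists_maximal_isRealOver R (AlgebraicClosure R)
  have := hasMemOrNegMem_squareCone hM
  let o : LinearOrder M := LinearOrder.mkOfAddGroupCone (squareCone hM.1)
  have : IsOrderedRing M := IsOrderedRing.mkOfCone (squareCone hM.1)
  have : IsStrictOrderedRing M := IsOrderedRing.toIsStrictOrderedRing M
  have hle : ∀ x y : M, x ≤ y ↔ (y : AlgebraicClosure R) - x ∈ weightedSquares M :=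
    fun x y => Iff.rfl
  have hsq : ∀ x : M, 0 ≤ x → IsSquare x := by
    intro x hx
    rw [hle] at hx
    obtain ⟨s, hs, e⟩ := exists_sq_eq_of_mem_weightedSquares hM hx
    refine ⟨⟨s, hs⟩, Subtype.ext ?_⟩
    have h0 : ((0 : M) : AlgebraicClosure R) = 0 := rfl
    rw [h0, sub_zero] at e
    rw [← e, pow_two]; rfl
  refine ⟨M, o, this, ?_, hsq, isAlgClosed_cpx hsq fun f hf => exists_isRoot_of_maximal hM hf⟩
  refine Monotone.strictMono_of_injective (fun r s hrs => ?_) (algebraMap R M).injective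
  rw [hle]
  -- A nonnegative element of R is in the cone as a weight times 1²; this is what the weights are
  -- for.
  have := mem_weightedSquares (sub_nonneg.2 hrs) (one_mem M)
  rw [one_pow, mul_one, map_sub] at this
  exact this

end RealClosure

/-! ### The intermediate value property and Rolle's theorem -/

section IntermediateValue

variable {R : Type*} [Field R] [LinearOrder R] [IsStrictOrderedRing R]

theorem IVT.mono {m n : ℕ} (h : IVT R n) (hmn : m ≤ n) : IVT R m :=
  fun F hF => h F (hF.trans hmn)

theorem IVT.mul_pos {n : ℕ} (h : IVT R n) {F : R[X]} (hF : F.natDegree ≤ n) {a b : R} (hab : a ≤ b)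
    (hroot : ∀ x, a ≤ x → x ≤ b → F.eval x ≠ 0) : 0 < F.eval a * F.eval b := by
  rcases hab.eq_or_lt with rfl | hab
  · exact mul_self_pos.2 (hroot a le_rfl le_rfl)
  by_contra hneg
  have hne := mul_ne_zero (hroot a le_rfl hab.le) (hroot b hab.le le_rfl)
  obtain ⟨c, hac, hcb, hc⟩ := h F hF a b hab (lt_of_le_of_ne (not_lt.1 hneg) hne)
  exact hroot c hac.le hcb.le hc

/-- A zero of F in the algebraically closed extension yields a linear or a positive quadratic factor
over the base. A factor taking values of the same sign at a and b can be removed without losing the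
sign change, so eventually a linear factor has its root in (a, b). -/
theorem ivt_of_isAlgClosed [IsAlgClosed (Cpx R)] (n : ℕ) : IVT R n := by
  intro F _ a b hab hneg
  induction hm : F.natDegree using Nat.strong_induction_on generalizing F with
  | _ m ih =>
  have hdeg : F.degree ≠ 0 := by
    intro h0
    rw [eq_C_of_degree_eq_zero h0] at hneg
    simp only [eval_C] at hneg
    exact absurd hneg (not_lt.2 (mul_self_nonneg _))
  have hF0 : F ≠ 0 := by rintro rfl; simp at hneg
  obtain ⟨ζ, hζ⟩ := IsAlgClosed.exists_aeval_eq_zero (Cpx R) F hdeg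
  have hfac : ∀ Q q : R[X], Q.Monic → 0 < Q.natDegree → F = Q * q →
      0 < Q.eval a * Q.eval b → ∃ c, a < c ∧ c < b ∧ F.eval c = 0 := by
    intro Q q hQ hQd hFq hpos
    have hq0 : q ≠ 0 := right_ne_zero_of_mul (hFq ▸ hF0)
    have hd : F.natDegree = Q.natDegree + q.natDegree := by
      rw [hFq, natDegree_mul hQ.ne_zero hq0]
    have hq : q.eval a * q.eval b < 0 := by
      rw [hFq, eval_mul, eval_mul] at hneg
      by_contra h
      nlinarith [mul_nonneg hpos.le (not_lt.1 h)]
    obtain ⟨c, h1, h2, h3⟩ := ih q.natDegree (by omega) q (by omega) hq rfl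
    exact ⟨c, h1, h2, by rw [hFq, eval_mul, h3, mul_zero]⟩
  by_cases him : ζ.im = 0
  · have hζ' : ζ = algebraMap R (Cpx R) ζ.re := by ext <;> simp [him]
    rw [hζ', aeval_algebraMap_apply_eq_algebraMap_eval, map_eq_zero_iff _
      (algebraMap R (Cpx R)).injective] at hζ
    by_cases hin : a < ζ.re ∧ ζ.re < b
    · exact ⟨_, hin.1, hin.2, hζ⟩
    obtain ⟨q, hq⟩ := dvd_iff_isRoot.2 hζ
    refine hfac _ q (monic_X_sub_C _) (by simp) hq ?_
    have ha : F.eval a ≠ 0 := left_ne_zero_of_mul hneg.ne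
    have hb : F.eval b ≠ 0 := right_ne_zero_of_mul hneg.ne
    have ha' : ζ.re ≠ a := by rintro rfl; exact ha hζ
    have hb' : ζ.re ≠ b := by rintro rfl; exact hb hζ
    simp only [eval_sub, eval_X, eval_C]
    rcases lt_or_gt_of_ne ha' with h | h
    · exact _root_.mul_pos (by linarith) (by linarith)
    · have h2 : b < ζ.re := lt_of_le_of_ne (not_lt.1 fun h' => hin ⟨h, h'⟩) hb'.symm
      exact mul_pos_of_neg_of_neg (by linarith) (by linarith)
  -- Q = (X - ζ)(X - ζ̄). The remainder of F modulo Q is at most linear and vanishes at the nonreal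
  -- ζ, hence is zero.
  · set Q : R[X] := X ^ 2 - C (2 * ζ.re) * X + C (ζ.re ^ 2 + ζ.im ^ 2) with hQ
    have hQe : Q = X ^ 2 + (C (-(2 * ζ.re)) * X + C (ζ.re ^ 2 + ζ.im ^ 2)) := by
      rw [hQ, C_neg]; ring
    have hlow : (C (-(2 * ζ.re)) * X + C (ζ.re ^ 2 + ζ.im ^ 2)).degree < ((2 : ℕ) : WithBot ℕ) :=
      degree_linear_lt
    have hQm : Q.Monic := hQe ▸ monic_X_pow_add hlow
    have hQd : Q.natDegree = 2 := by rw [hQ]; compute_degree!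
    have hQeval : ∀ x, Q.eval x = (x - ζ.re) ^ 2 + ζ.im ^ 2 := by
      intro x; simp [hQ]; ring
    have hQζ : aeval ζ Q = 0 := by
      ext <;> simp [hQ, pow_two] <;> ring
    have hmod : aeval ζ (F %ₘ Q) = 0 := by
      have := congrArg (aeval ζ) (modByMonic_add_div F Q)
      rwa [map_add, map_mul, hQζ, zero_mul, add_zero, hζ] at this
    have hlt := natDegree_modByMonic_lt F hQm fun h => by simp [h] at hQd
    rw [hQd] at hlt
    have hr : F %ₘ Q = C ((F %ₘ Q).coeff 1) * X + C ((F %ₘ Q).coeff 0) :=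
      eq_X_add_C_of_natDegree_le_one (Nat.le_of_lt_succ hlt)
    have hzero : F %ₘ Q = 0 := by
      rw [hr] at hmod ⊢
      have h1 := congrArg QuadraticAlgebra.im hmod
      have h2 := congrArg QuadraticAlgebra.re hmod
      simp [him] at h1
      simp [h1] at h2
      simp [h1, h2]
    obtain ⟨q, hq⟩ := (modByMonic_eq_zero_iff_dvd hQm).1 hzero
    refine hfac Q q hQm (by omega) hq ?_
    rw [hQeval, hQeval]
    have : 0 < ζ.im ^ 2 := by positivity
    positivity

/-- Rolle's theorem between consecutive roots. -/
theorem exists_derivative_eval_eq_zero (h : ∀ n, IVT R n) {F : R[X]} (hF : F ≠ 0) {a b : R}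
    (hab : a < b) (ha : F.eval a = 0) (hb : F.eval b = 0)
    (hroot : ∀ x, a < x → x < b → F.eval x ≠ 0) :
    ∃ c, a < c ∧ c < b ∧ F.derivative.eval c = 0 := by
  obtain ⟨G, hG, hGa⟩ := exists_eq_pow_rootMultiplicity_mul_and_not_dvd F hF a
  have hm : 0 < F.rootMultiplicity a := (rootMultiplicity_pos hF).2 ha
  set m := F.rootMultiplicity a
  have hG0 : G ≠ 0 := by rintro rfl; simp at hGa
  obtain ⟨H, hH, hHb⟩ := exists_eq_pow_rootMultiplicity_mul_and_not_dvd G hG0 b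
  have hGb : G.eval b = 0 := by
    rw [hG, eval_mul] at hb
    refine (mul_eq_zero.1 hb).resolve_left ?_
    simpa using fun h => absurd h (sub_pos.2 hab).ne'
  have hk : 0 < G.rootMultiplicity b := (rootMultiplicity_pos hG0).2 hGb
  set k := G.rootMultiplicity b
  rw [dvd_iff_isRoot, IsRoot.def] at hGa hHb
  obtain ⟨m, hm⟩ := Nat.exists_eq_succ_of_ne_zero hm.ne'
  obtain ⟨k, hk⟩ := Nat.exists_eq_succ_of_ne_zero hk.ne'
  rw [hm] at hG
  rw [hk] at hH
  have hFe : F = (X - C a) ^ (m + 1) * ((X - C b) ^ (k + 1) * H) := by rw [← hH]; exact hG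
  have hHne : ∀ x, a ≤ x → x ≤ b → H.eval x ≠ 0 := by
    intro x hax hxb h0
    rcases hax.eq_or_lt with rfl | hax
    · apply hGa; rw [hH, eval_mul, h0, mul_zero]
    rcases hxb.eq_or_lt with rfl | hxb
    · exact hHb h0
    · apply hroot x hax hxb; rw [hFe]; simp [h0]
  have hpos := (h _).mul_pos le_rfl hab.le hHne
  -- F' = (X - a)^m (X - b)^k D. At a and b one term of D survives, with factors (m+1)(a-b) and
  -- (k+1)(b-a) of opposite signs, while the cofactor H keeps its sign.
  set D : R[X] := C (m + 1 : R) * (X - C b) * H + C (k + 1 : R) * (X - C a) * H +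
    (X - C a) * (X - C b) * H.derivative with hD
  have hder : F.derivative = (X - C a) ^ m * (X - C b) ^ k * D := by
    rw [hFe, hD]
    simp only [derivative_mul, derivative_X_sub_C_pow, add_tsub_cancel_right, Nat.cast_add,
      Nat.cast_one, C_add, C_1, map_natCast]
    ring
  have hDneg : D.eval a * D.eval b < 0 := by
    have h1 : D.eval a = (m + 1) * (a - b) * H.eval a := by simp [hD]
    have h2 : D.eval b = (k + 1) * (b - a) * H.eval b := by simp [hD]
    rw [h1, h2]
    have hm0 : (0 : R) < m + 1 := by positivity
    have hk0 : (0 : R) < k + 1 := by positivity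
    have hba : 0 < b - a := sub_pos.2 hab
    have : 0 < ((m : R) + 1) * (k + 1) * (b - a) ^ 2 * (H.eval a * H.eval b) := by positivity
    nlinarith [this]
  obtain ⟨c, h1, h2, h3⟩ := h _ D le_rfl a b hab hDneg
  exact ⟨c, h1, h2, by rw [hder, eval_mul, h3, mul_zero]⟩

end IntermediateValue

/-! ### Descent of roots to R, and zeros in R[i] -/

section Descent

variable {R L : Type*} [Field R] [LinearOrder R] [IsStrictOrderedRing R]
  [Field L] [LinearOrder L] [IsStrictOrderedRing L] [Algebra R L]

theorem algebraMap_abs (hmono : StrictMono (algebraMap R L)) (r : R) :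
    algebraMap R L |r| = |algebraMap R L r| := by
  rcases le_total 0 r with h | h
  · have := hmono.monotone h
    rw [map_zero] at this
    rw [abs_of_nonneg h, abs_of_nonneg this]
  · have := hmono.monotone h
    rw [map_zero] at this
    rw [abs_of_nonpos h, abs_of_nonpos this, map_neg]

/-- Cauchy's bound: if |α| ≥ 1, the leading term forces |α| to be at most the sum of the other
|coefficients| over the leading one. It bounds α by elements of R. -/
theorem exists_abs_lt_of_aeval_eq_zero (hmono : StrictMono (algebraMap R L)) {P : R[X]}
    (hP : P ≠ 0) {α : L} (hα : aeval α P = 0) : ∃ B : R, |α| < algebraMap R L B := by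
  set n := P.natDegree with hn
  set S : R := ∑ i ∈ Finset.range n, |P.coeff i| with hS
  have hlc : 0 < |P.coeff n| := abs_pos.2 (leadingCoeff_ne_zero.2 hP)
  have hS0 : 0 ≤ S := Finset.sum_nonneg fun _ _ => abs_nonneg _
  refine ⟨1 + S / |P.coeff n|, ?_⟩
  by_contra! hle
  have hB : (1 : L) ≤ algebraMap R L (1 + S / |P.coeff n|) := by
    rw [← map_one (algebraMap R L)]
    exact hmono.monotone (le_add_of_nonneg_right (by positivity))
  have hα1 : 1 ≤ |α| := hB.trans hle
  have hn0 : n ≠ 0 := by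
    intro h0
    rw [eq_C_of_natDegree_eq_zero (p := P) h0, aeval_C] at hα
    apply hP
    rw [eq_C_of_natDegree_eq_zero (p := P) h0, (map_eq_zero _).1 hα, C_0]
  have hlcL : 0 < algebraMap R L |P.coeff n| := by simpa using hmono hlc
  have h1 : algebraMap R L |P.coeff n| * |α| ^ n ≤ algebraMap R L S * |α| ^ (n - 1) := by
    have e := aeval_eq_sum_range (p := P) α
    rw [hα, ← hn, Finset.sum_range_succ] at e
    have e' : P.coeff n • α ^ n = -∑ i ∈ Finset.range n, P.coeff i • α ^ i := by
      linear_combination -e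
    calc algebraMap R L |P.coeff n| * |α| ^ n = |P.coeff n • α ^ n| := by
          rw [Algebra.smul_def, abs_mul, abs_pow, algebraMap_abs hmono]
      _ = |∑ i ∈ Finset.range n, P.coeff i • α ^ i| := by rw [e', abs_neg]
      _ ≤ ∑ i ∈ Finset.range n, |P.coeff i • α ^ i| := Finset.abs_sum_le_sum_abs _ _
      _ ≤ ∑ i ∈ Finset.range n, algebraMap R L |P.coeff i| * |α| ^ (n - 1) := by
          refine Finset.sum_le_sum fun i hi => ?_
          rw [Algebra.smul_def, abs_mul, abs_pow, algebraMap_abs hmono]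
          have := Finset.mem_range.1 hi
          exact mul_le_mul_of_nonneg_left (pow_le_pow_right₀ hα1 (by omega)) (abs_nonneg _)
      _ = _ := by rw [← Finset.sum_mul, hS, map_sum]
  have h2 : |α| ^ n = |α| * |α| ^ (n - 1) := by
    rw [← pow_succ', Nat.sub_add_cancel (Nat.one_le_iff_ne_zero.2 hn0)]
  have hpow : 0 < |α| ^ (n - 1) := by positivity
  rw [h2, ← mul_assoc] at h1
  have h3 := le_of_mul_le_mul_right h1 hpow
  have h4 := mul_le_mul_of_nonneg_left hle hlcL.le
  rw [← map_mul, mul_add, mul_one, mul_div_cancel₀ _ hlc.ne', map_add] at h4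
  linarith

/-- R need not be dense in L, so the separating point comes from Rolle: a zero of F' between α and
the preceding root of F, which `hder` places in R. If no root precedes α, `r₀` serves. -/
theorem exists_lt_forall_eval_ne_zero (hL : ∀ n, IVT L n) {F : L[X]} (hF : F ≠ 0) {α : L}
    (hα : F.eval α = 0) {r₀ : R} (hr₀ : algebraMap R L r₀ < α)
    (hder : ∀ c, F.derivative.eval c = 0 → ∃ r : R, algebraMap R L r = c) :
    ∃ r : R, algebraMap R L r < α ∧
      ∀ x, algebraMap R L r ≤ x → x < α → F.eval x ≠ 0 := by
  by_cases hne : (F.roots.toFinset.filter (· < α)).Nonempty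
  · set b := (F.roots.toFinset.filter (· < α)).max' hne with hb
    have hmem := Finset.max'_mem _ hne
    rw [← hb, Finset.mem_filter, Multiset.mem_toFinset, mem_roots hF] at hmem
    have hmax : ∀ x, b < x → x < α → F.eval x ≠ 0 := fun x hbx hxα h0 => by
      refine absurd (Finset.le_max' _ x ?_) (not_le.2 hbx)
      rw [Finset.mem_filter, Multiset.mem_toFinset, mem_roots hF]
      exact ⟨h0, hxα⟩
    obtain ⟨c, hbc, hcα, hc⟩ := exists_derivative_eval_eq_zero hL hF hmem.2 hmem.1 hα hmax
    obtain ⟨r, rfl⟩ := hder c hc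
    exact ⟨r, hcα, fun x hx hxα => hmax x (hbc.trans_le hx) hxα⟩
  · refine ⟨r₀, hr₀, fun x _ hxα h0 => hne ⟨x, ?_⟩⟩
    rw [Finset.mem_filter, Multiset.mem_toFinset, mem_roots hF]
    exact ⟨h0, hxα⟩

theorem exists_gt_forall_eval_ne_zero (hL : ∀ n, IVT L n) {F : L[X]} (hF : F ≠ 0) {α : L}
    (hα : F.eval α = 0) {r₀ : R} (hr₀ : α < algebraMap R L r₀)
    (hder : ∀ c, F.derivative.eval c = 0 → ∃ r : R, algebraMap R L r = c) :
    ∃ r : R, α < algebraMap R L r ∧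
      ∀ x, α < x → x ≤ algebraMap R L r → F.eval x ≠ 0 := by
  by_cases hne : (F.roots.toFinset.filter (α < ·)).Nonempty
  · set b := (F.roots.toFinset.filter (α < ·)).min' hne with hb
    have hmem := Finset.min'_mem _ hne
    rw [← hb, Finset.mem_filter, Multiset.mem_toFinset, mem_roots hF] at hmem
    have hmin : ∀ x, α < x → x < b → F.eval x ≠ 0 := fun x hαx hxb h0 => by
      refine absurd (Finset.min'_le _ x ?_) (not_le.2 hxb)
      rw [Finset.mem_filter, Multiset.mem_toFinset, mem_roots hF]
      exact ⟨h0, hαx⟩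
    obtain ⟨c, hαc, hcb, hc⟩ := exists_derivative_eval_eq_zero hL hF hmem.2 hα hmem.1 hmin
    obtain ⟨r, rfl⟩ := hder c hc
    exact ⟨r, hαc, fun x hαx hx => hmin x hαx (hx.trans_lt hcb)⟩
  · refine ⟨r₀, hr₀, fun x hαx _ h0 => hne ⟨x, ?_⟩⟩
    rw [Finset.mem_filter, Multiset.mem_toFinset, mem_roots hF]
    exact ⟨h0, hαx⟩

/-- If `R` has the intermediate value property in degree `n`, then it contains the roots, in an
ordered extension with the intermediate value property, of all polynomials of degree at most
`n`. -/
theorem IVT.exists_algebraMap_eq {n : ℕ} (hR : IVT R n) (hL : ∀ n, IVT L n)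
    (hmono : StrictMono (algebraMap R L)) {P : R[X]} (hP : P ≠ 0) (hn : P.natDegree ≤ n) {α : L}
    (hα : aeval α P = 0) : ∃ r : R, algebraMap R L r = α := by
  induction hm : P.natDegree using Nat.strong_induction_on generalizing P α with
  | _ m ih =>
  have hpos : 0 < P.natDegree := by
    by_contra h0
    have h0 : P.natDegree = 0 := by omega
    rw [eq_C_of_natDegree_eq_zero (p := P) h0, aeval_C] at hα
    apply hP
    rw [eq_C_of_natDegree_eq_zero (p := P) h0, (map_eq_zero _).1 hα, C_0]
  have hlt := natDegree_derivative_lt hpos.ne'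
  have hder0 : P.derivative ≠ 0 := fun h => by
    have := derivative_eq_zero.1 h
    omega
  have hder : ∀ c : L, aeval c P.derivative = 0 → ∃ r : R, algebraMap R L r = c :=
    fun c hc => ih _ (hm ▸ hlt) hder0 (by omega) hc rfl
  by_cases hα' : aeval α P.derivative = 0
  · exact hder α hα'
  set F := P.map (algebraMap R L) with hF
  have hF0 : F ≠ 0 := map_ne_zero hP
  have hev : ∀ x, F.eval x = aeval x P := fun x => eval_map_algebraMap P x
  have hev' : ∀ x, F.derivative.eval x = aeval x P.derivative := fun x => by
    rw [hF, derivative_map]; exact eval_map_algebraMap _ x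
  have hFα : F.eval α = 0 := by rw [hev, hα]
  obtain ⟨B, hB⟩ := exists_abs_lt_of_aeval_eq_zero hmono hP hα
  obtain ⟨hB1, hB2⟩ := abs_lt.1 hB
  obtain ⟨r, hrα, hr⟩ := exists_lt_forall_eval_ne_zero hL hF0 hFα (r₀ := -B) (by rwa [map_neg])
    (fun c hc => hder c (by rwa [← hev']))
  obtain ⟨s, hαs, hs⟩ := exists_gt_forall_eval_ne_zero hL hF0 hFα hB2
    (fun c hc => hder c (by rwa [← hev']))
  -- α is now a simple root and the only one in [r, s]. The cofactor q keeps its sign there, so P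
  -- changes sign between r and s, and the zero supplied by R must be α.
  obtain ⟨q, hq⟩ := dvd_iff_isRoot.2 hFα
  have hqα : q.eval α ≠ 0 := by
    rw [← hev', hq] at hα'
    simpa [derivative_mul] using hα'
  have hqne : ∀ x, algebraMap R L r ≤ x → x ≤ algebraMap R L s → q.eval x ≠ 0 := by
    intro x hx hx' h0
    have hFx : F.eval x = 0 := by rw [hq, eval_mul, h0, mul_zero]
    rcases lt_trichotomy x α with h | rfl | h
    · exact hr x hx h hFx
    · exact hqα h0
    · exact hs x h hx' hFx
  have hrs : r < s := hmono.lt_iff_lt.1 (hrα.trans hαs)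
  have hqpos := (hL _).mul_pos le_rfl (hmono hrs).le hqne
  have hneg : P.eval r * P.eval s < 0 := by
    rw [← hmono.lt_iff_lt, map_mul, map_zero, ← aeval_algebraMap_apply_eq_algebraMap_eval,
      ← aeval_algebraMap_apply_eq_algebraMap_eval, ← hev, ← hev, hq]
    simp only [eval_mul, eval_sub, eval_X, eval_C]
    nlinarith [_root_.mul_pos (_root_.mul_pos (sub_pos.2 hrα) (sub_pos.2 hαs)) hqpos]
  obtain ⟨c, hrc, hcs, hc⟩ := hR P hn r s hrs hneg
  have hFc : F.eval (algebraMap R L c) = 0 := by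
    rw [hev, aeval_algebraMap_apply_eq_algebraMap_eval, hc, map_zero]
  refine ⟨c, ?_⟩
  rcases lt_trichotomy (algebraMap R L c) α with h | h | h
  · exact absurd hFc (hr _ (hmono hrc).le h)
  · exact h
  · exact absurd hFc (hs _ h (hmono hcs).le)

variable (R L) in
/-- The inclusion of `R[i]` into `L[i]`. -/
def cpxMap : Cpx R →+* Cpx L where
  toFun z := ⟨algebraMap R L z.re, algebraMap R L z.im⟩
  map_one' := by ext <;> simp [QuadraticAlgebra.re_one, QuadraticAlgebra.im_one]
  map_mul' x y := by ext <;> simp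
  map_zero' := by ext <;> simp
  map_add' x y := by ext <;> simp

variable (R) in
/-- Complex conjugation on `R[i]`. -/
def conj : Cpx R →+* Cpx R where
  toFun z := ⟨z.re, -z.im⟩
  map_one' := by ext <;> simp [QuadraticAlgebra.re_one, QuadraticAlgebra.im_one]
  map_mul' x y := by ext <;> simp; ring
  map_zero' := by ext <;> simp
  map_add' x y := by ext <;> simp; ring

/-- Since y is real, taking real parts of coefficients commutes with evaluation at y. Monicity keeps
the top coefficient equal to 1, so the result is nonzero. -/
theorem exists_aeval_re_eq_zero {m : (Cpx R)[X]} (hm : m.Monic) {y : L}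
    (hy : m.eval₂ (cpxMap R L) (algebraMap L (Cpx L) y) = 0) :
    ∃ A : R[X], A ≠ 0 ∧ A.natDegree ≤ m.natDegree ∧ aeval y A = 0 := by
  set A : R[X] := ∑ i ∈ Finset.range (m.natDegree + 1), monomial i (m.coeff i).re with hA
  have hlead : A.coeff m.natDegree = 1 := by
    rw [hA, finsetSum_coeff]
    simp only [coeff_monomial]
    rw [Finset.sum_ite_eq' (Finset.range (m.natDegree + 1)), if_pos (by simp), coeff_natDegree,
      hm.leadingCoeff]
    rfl
  refine ⟨A, fun h => by simp [h] at hlead, ?_, ?_⟩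
  · refine natDegree_sum_le_of_forall_le _ _ fun i hi => (natDegree_monomial_le _).trans ?_
    have := Finset.mem_range.1 hi
    omega
  · rw [eval₂_eq_sum_range] at hy
    have h1 := congrArg (QuadraticAlgebra.reₗ (-1 : L) 0) hy
    rw [map_sum, map_zero] at h1
    rw [hA, map_sum, ← h1]
    refine Finset.sum_congr rfl fun i _ => ?_
    have e : algebraMap L (Cpx L) y ^ i = algebraMap L (Cpx L) (y ^ i) := (map_pow _ _ _).symm
    rw [e, aeval_monomial, QuadraticAlgebra.reₗ_apply, QuadraticAlgebra.re_mul,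
      QuadraticAlgebra.algebraMap_re, QuadraticAlgebra.algebraMap_im, mul_zero, add_zero]
    rfl

open IntermediateField in
theorem isIntegral_and_natDegree_minpoly_le_of_mem_sup {k K : Type*} [Field k] [Field K] [Algebra k K] {x y w : K}
    (hx : IsIntegral k x) (hy : IsIntegral k y) (hw : w ∈ k⟮x⟯ ⊔ k⟮y⟯) :
    IsIntegral k w ∧
      (minpoly k w).natDegree ≤ (minpoly k x).natDegree * (minpoly k y).natDegree := by
  have : FiniteDimensional k k⟮x⟯ := adjoin.finiteDimensional hx
  have : FiniteDimensional k k⟮y⟯ := adjoin.finiteDimensional hy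
  have := IntermediateField.finiteDimensional_sup k⟮x⟯ k⟮y⟯
  refine ⟨(IsIntegral.of_finite k (⟨w, hw⟩ : (k⟮x⟯ ⊔ k⟮y⟯ : IntermediateField k K))).map
    (IntermediateField.val _), ?_⟩
  have h := (minpoly.natDegree_le (A := k) (⟨w, hw⟩ : (k⟮x⟯ ⊔ k⟮y⟯ : IntermediateField k K))).trans
    (finrank_sup_le _ _)
  rwa [adjoin.finrank hx, adjoin.finrank hy, ← minpoly.algebraMap_eq
    (algebraMap (k⟮x⟯ ⊔ k⟮y⟯ : IntermediateField k K) K).injective] at h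

open IntermediateField in
/-- The fundamental theorem of algebra in degree `d`, from the intermediate value property in
degree `d ^ 2`. -/
theorem IVT.exists_eval_eq_zero {d : ℕ} (hR : IVT R (d ^ 2)) {F : (Cpx R)[X]}
    (hF : F.natDegree ≠ 0) (hFd : F.natDegree ≤ d) : ∃ z, F.eval z = 0 := by
  obtain ⟨L, _, _, hmono, -, _⟩ := exists_ordered_extension_isAlgClosed R
  have hL : ∀ n, IVT L n := fun n => ivt_of_isAlgClosed n
  let φ := cpxMap R L
  let _ : Algebra (Cpx R) (Cpx L) := φ.toAlgebra
  have hF0 : F ≠ 0 := by rintro rfl; simp at hF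
  obtain ⟨ζ, hζ⟩ := IsAlgClosed.exists_eval₂_eq_zero φ F
    (by rw [degree_eq_natDegree hF0]; exact_mod_cast hF)
  change aeval ζ F = 0 at hζ
  -- Re ζ and Im ζ are rational expressions in ζ, ζ̄ and i. The field R[i](ζ) need not contain ζ̄,
  -- hence the compositum and the bound d·d.
  set ζ' := conj L ζ with hζ'
  have hconj : (conj L).comp φ = φ.comp (conj R) := by
    ext z <;> simp [φ, conj, cpxMap]
  have hζ'0 : aeval ζ' (F.map (conj R)) = 0 := by
    have := congrArg (conj L) hζ
    rw [aeval_def, hom_eval₂, map_zero] at this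
    rw [aeval_def, eval₂_map]
    exact hconj ▸ this
  have hFc0 : F.map (conj R) ≠ 0 := map_ne_zero hF0
  have hint : IsIntegral (Cpx R) ζ := IsAlgebraic.isIntegral ⟨F, hF0, hζ⟩
  have hint' : IsIntegral (Cpx R) ζ' := IsAlgebraic.isIntegral ⟨_, hFc0, hζ'0⟩
  have hd : (minpoly (Cpx R) ζ).natDegree ≤ d :=
    (natDegree_le_of_dvd (minpoly.dvd _ _ hζ) hF0).trans hFd
  have hd' : (minpoly (Cpx R) ζ').natDegree ≤ d :=
    (natDegree_le_of_dvd (minpoly.dvd _ _ hζ'0) hFc0).trans (by rwa [natDegree_map])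
  set E := (Cpx R)⟮ζ⟯ ⊔ (Cpx R)⟮ζ'⟯ with hE
  have hζE : ζ ∈ E := (le_sup_left : _ ≤ E) (mem_adjoin_simple_self _ _)
  have hζ'E : ζ' ∈ E := (le_sup_right : _ ≤ E) (mem_adjoin_simple_self _ _)
  have key : ∀ y : L, algebraMap L (Cpx L) y ∈ E → ∃ r : R, algebraMap R L r = y := by
    intro y hy
    obtain ⟨hw, hwd⟩ := isIntegral_and_natDegree_minpoly_le_of_mem_sup hint hint' hy
    obtain ⟨A, hA0, hAd, hA⟩ := exists_aeval_re_eq_zero (y := y) (minpoly.monic hw)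
      (minpoly.aeval (Cpx R) (algebraMap L (Cpx L) y))
    refine hR.exists_algebraMap_eq hL hmono hA0 (hAd.trans (hwd.trans ?_)) hA
    rw [pow_two]
    exact Nat.mul_le_mul hd hd'
  obtain ⟨a, ha⟩ := key ζ.re (by
    have h2 : algebraMap L (Cpx L) ζ.re = (ζ + ζ') / 2 := by
      rw [eq_div_iff two_ne_zero, mul_two]
      ext <;> simp [hζ', conj]
    rw [h2]
    exact div_mem (add_mem hζE hζ'E) (ofNat_mem E 2))
  obtain ⟨b, hb⟩ := key ζ.im (by
    have hi : φ ⟨0, 1⟩ ∈ E := E.algebraMap_mem _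
    have h2 : algebraMap L (Cpx L) ζ.im = (ζ' - ζ) * φ ⟨0, 1⟩ / 2 := by
      rw [eq_div_iff two_ne_zero, mul_two]
      ext <;> simp [hζ', conj, φ, cpxMap]
    rw [h2]
    exact div_mem (mul_mem (sub_mem hζ'E hζE) hi) (ofNat_mem E 2))
  refine ⟨⟨a, b⟩, φ.injective ?_⟩
  have hz : φ ⟨a, b⟩ = ζ := by ext <;> simp [φ, cpxMap, ha, hb]
  rw [map_zero, ← eval₂_at_apply, hz]
  exact hζ

end Descent

end FieldStructure

/-! ### Signs and the local product formula -/

section SignValue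

variable {R : Type*} [Field R] [LinearOrder R] [IsStrictOrderedRing R]

/-- The sign of an element as a rational number. -/
def sgn (x : R) : ℚ := ((SignType.sign x : SignType) : ℚ)

@[simp] theorem sgn_zero : sgn (0 : R) = 0 := by simp [sgn]

theorem sgn_of_pos {x : R} (h : 0 < x) : sgn x = 1 := by simp [sgn, sign_pos h]

theorem sgn_of_neg {x : R} (h : x < 0) : sgn x = -1 := by simp [sgn, sign_neg h]

theorem sgn_mul (x y : R) : sgn (x * y) = sgn x * sgn y := by
  unfold sgn
  rw [sign_mul]
  generalize SignType.sign x = s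
  generalize SignType.sign y = t
  cases s <;> cases t <;> simp

theorem sgn_pow (x : R) (n : ℕ) : sgn (x ^ n) = sgn x ^ n := by
  induction n with
  | zero => simp [sgn_of_pos]
  | succ n ih => rw [pow_succ, sgn_mul, ih, pow_succ]

theorem sgn_mul_self {x : R} (h : x ≠ 0) : sgn x * sgn x = 1 := by
  rw [← sgn_mul, sgn_of_pos (mul_self_pos.2 h)]

theorem sgn_eq_of_mul_pos {x y : R} (h : 0 < x * y) : sgn x = sgn y := by
  rcases pos_and_pos_or_neg_and_neg_of_mul_pos h with ⟨h1, h2⟩ | ⟨h1, h2⟩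
  · rw [sgn_of_pos h1, sgn_of_pos h2]
  · rw [sgn_of_neg h1, sgn_of_neg h2]

theorem sgn_neg (x : R) : sgn (-x) = -sgn x := by
  rw [neg_eq_neg_one_mul, sgn_mul, sgn_of_neg (by norm_num : (-1 : R) < 0)]; ring

theorem sgn_add_sub_sub (u v : R) :
    sgn (u + v) - sgn u - sgn v = -(sgn u * sgn v * sgn (u + v)) := by
  rcases lt_trichotomy u 0 with hu | rfl | hu <;> rcases lt_trichotomy v 0 with hv | rfl | hv
  · rw [sgn_of_neg hu, sgn_of_neg hv, sgn_of_neg (add_neg hu hv)]; norm_num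
  · simp
  · rw [sgn_of_neg hu, sgn_of_pos hv]; ring
  · simp
  · simp
  · simp
  · rw [sgn_of_pos hu, sgn_of_neg hv]; ring
  · simp
  · rw [sgn_of_pos hu, sgn_of_pos hv, sgn_of_pos (add_pos hu hv)]; norm_num

/-- The index of a germ with value `p + i q` at its origin and sign of the imaginary part that of
`q'` beyond it. -/
def germIndex (p q q' : R) : ℚ := if q = 0 then 1 / 2 * sgn p * sgn q' else 0

/-- The defect in the additivity of the index of two germs. -/
def defect (u v t : R) : ℚ := -(1 / 2) * (sgn u * sgn v * sgn t)

/-- Primes denote values at a nearby point. If q = s = 0, division by p'r' reduces the claim to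
`sgn_add_sub_sub` for q'/p' and s'/r'. If exactly one of q, s vanishes, the sign of ps + rq is
known. If neither does, only ps + rq = 0 matters, and then pr - qs has the sign of -qs. -/
theorem germIndex_mul {p q r s p' q' r' s' : R} (hpq : p ≠ 0 ∨ q ≠ 0) (hrs : r ≠ 0 ∨ s ≠ 0)
    (hp : p ≠ 0 → sgn p' = sgn p) (hq : q ≠ 0 → sgn q' = sgn q)
    (hr : r ≠ 0 → sgn r' = sgn r) (hs : s ≠ 0 → sgn s' = sgn s)
    (ht : p * s + r * q ≠ 0 → sgn (p' * s' + r' * q') = sgn (p * s + r * q)) :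
    germIndex (p * r - q * s) (p * s + r * q) (p' * s' + r' * q') - germIndex p q q'
      - germIndex r s s' = defect q' s' (p' * s' + r' * q') - defect q s (p * s + r * q) := by
  unfold germIndex defect
  by_cases hq0 : q = 0
  · have hp0 : p ≠ 0 := hpq.resolve_right (not_not.2 hq0)
    by_cases hs0 : s = 0
    · have hr0 : r ≠ 0 := hrs.resolve_right (not_not.2 hs0)
      have hp1 := sgn_mul_self hp0
      have hr1 := sgn_mul_self hr0
      have hpp : p' ≠ 0 := by rintro rfl; rw [← hp hp0] at hp1; simp at hp1
      have hrr : r' ≠ 0 := by rintro rfl; rw [← hr hr0] at hr1; simp at hr1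
      have h1 : sgn q' = sgn p * sgn (q' / p') := by
        rw [← hp hp0, ← sgn_mul, mul_div_cancel₀ _ hpp]
      have h2 : sgn s' = sgn r * sgn (s' / r') := by
        rw [← hr hr0, ← sgn_mul, mul_div_cancel₀ _ hrr]
      have h3 : sgn (p' * s' + r' * q') = sgn p * sgn r * sgn (q' / p' + s' / r') := by
        rw [← hp hp0, ← hr hr0, ← sgn_mul, ← sgn_mul]
        congr 1
        field_simp
        ring
      have h4 := sgn_add_sub_sub (q' / p') (s' / r')
      simp only [hq0, hs0, mul_zero, add_zero, sub_zero, if_true, sgn_zero]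
      rw [h1, h2, h3, sgn_mul]
      linear_combination (1 / 2 : ℚ) * h4 +
        (1 / 2 * sgn r * sgn r * sgn (q' / p' + s' / r') - 1 / 2 * sgn (q' / p') +
          1 / 2 * sgn r * sgn r * sgn (q' / p') * sgn (s' / r') * sgn (q' / p' + s' / r')) * hp1 +
        (1 / 2 * sgn (q' / p' + s' / r') - 1 / 2 * sgn (s' / r') +
          1 / 2 * sgn (q' / p') * sgn (s' / r') * sgn (q' / p' + s' / r')) * hr1
    · have ht0 : p * s + r * q ≠ 0 := by rw [hq0, mul_zero, add_zero]; exact mul_ne_zero hp0 hs0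
      rw [if_neg ht0, if_pos hq0, if_neg hs0, ht ht0, hs hs0]
      simp only [hq0, mul_zero, add_zero, sgn_mul, sgn_zero, zero_mul, sub_zero]
      linear_combination (1 / 2 * sgn p * sgn q') * sgn_mul_self hs0
  · by_cases hs0 : s = 0
    · have hr0 : r ≠ 0 := hrs.resolve_right (not_not.2 hs0)
      have ht0 : p * s + r * q ≠ 0 := by rw [hs0, mul_zero, zero_add]; exact mul_ne_zero hr0 hq0
      rw [if_neg ht0, if_neg hq0, if_pos hs0, ht ht0, hq hq0]
      simp only [hs0, mul_zero, zero_add, sgn_mul, sgn_zero, zero_mul, sub_zero]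
      linear_combination (1 / 2 * sgn r * sgn s') * sgn_mul_self hq0
    · rw [if_neg hq0, if_neg hs0, hq hq0, hs hs0]
      by_cases ht0 : p * s + r * q = 0
      · rw [if_pos ht0, ht0]
        have hneg : sgn (p * r - q * s) = -(sgn q * sgn s) := by
          rw [← sgn_mul, ← sgn_neg]
          apply sgn_eq_of_mul_pos
          have e : (p * r - q * s) * -(q * s) = q ^ 2 * (r ^ 2 + s ^ 2) := by
            linear_combination (-r * q) * ht0
          rw [e]
          positivity
        rw [hneg]; simp; ring
      · rw [if_neg ht0, ht ht0]; ring

end SignValue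

/-! ### The Cauchy index and its product formula -/

section Index

variable {R : Type*} [Field R] [LinearOrder R] [IsStrictOrderedRing R]

theorem indSide_eq_zero (ε : ℤˣ) (x : R) (A B : R[X]) (h : B.eval x ≠ 0) :
    indSide ε x A B = 0 := by
  have : B.rootMultiplicity x = 0 := rootMultiplicity_eq_zero h
  simp [indSide, this]

theorem indSide_eq (ε : ℤˣ) {x : R} {A B : R[X]} (hB : B ≠ 0) (hBx : B.eval x = 0)
    (hA : A.eval x ≠ 0) :
    indSide ε x A B = 1 / 2 * sgn (A.eval x) *
      (((ε : ℤ) : ℚ) ^ B.rootMultiplicity x * sgn ((cofactor x B).eval x)) := by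
  have h0 : A.rootMultiplicity x = 0 := rootMultiplicity_eq_zero hA
  have hpos : 0 < B.rootMultiplicity x := (rootMultiplicity_pos hB).2 hBx
  have hA0 : A ≠ 0 := by rintro rfl; simp at hA
  have hcof : cofactor x A = A := by simp [cofactor, h0]
  rw [indSide, if_pos ⟨hB, hA0, h0 ▸ hpos⟩, hcof, h0, Nat.sub_zero]
  change _ * sgn _ = _
  rw [sgn_mul]; ring

theorem cofactor_spec (x : R) (B : R[X]) :
    B = (X - C x) ^ B.rootMultiplicity x * cofactor x B :=
  (pow_mul_divByMonic_rootMultiplicity_eq B x).symm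

theorem natDegree_cofactor_le (x : R) (B : R[X]) : (cofactor x B).natDegree ≤ B.natDegree := by
  unfold cofactor
  rw [natDegree_divByMonic _ ((monic_X_sub_C x).pow _)]
  exact Nat.sub_le _ _

theorem cofactor_eval_ne_zero {x : R} {B : R[X]} (hB : B ≠ 0) {y : R}
    (hy : y ≠ x → B.eval y ≠ 0) : (cofactor x B).eval y ≠ 0 := by
  by_cases hyx : y = x
  · rw [hyx]; exact eval_divByMonic_pow_rootMultiplicity_ne_zero x hB
  · intro h
    apply hy hyx
    rw [cofactor_spec x B, eval_mul, h, mul_zero]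

/-- The cofactor of B has no root on [a, c], hence constant sign, so the sign entering the index is
that of B(c). The form of `hroot` admits B = 0. On the left of a point, (c - b)^μ accounts for the
factor (-1)^μ. -/
theorem indSide_one_eq {n : ℕ} (hR : IVT R n) {A B : R[X]} (hBn : B.natDegree ≤ n) {a c : R}
    (hac : a < c) (hroot : ∀ x, a < x → x ≤ c → B.eval x = 0 → B = 0)
    (hne : A.eval a ≠ 0 ∨ B.eval a ≠ 0) :
    indSide 1 a A B = germIndex (A.eval a) (B.eval a) (B.eval c) := by
  unfold germIndex
  split_ifs with h
  · by_cases hB : B = 0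
    · simp [indSide, hB]
    rw [indSide_eq 1 hB h (hne.resolve_right (not_not.2 h))]
    have hpos := (hR.mono ((natDegree_cofactor_le a B).trans hBn)).mul_pos le_rfl hac.le
      (fun x hax hxc => cofactor_eval_ne_zero hB fun hxa h0 =>
        hB (hroot x (lt_of_le_of_ne hax (Ne.symm hxa)) hxc h0))
    conv_rhs => rw [cofactor_spec a B]
    rw [eval_mul, sgn_mul, eval_pow, sgn_pow, eval_sub, eval_X, eval_C,
      sgn_of_pos (sub_pos.2 hac), sgn_eq_of_mul_pos hpos]
    simp
  · exact indSide_eq_zero _ _ _ _ h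

theorem indSide_neg_one_eq {n : ℕ} (hR : IVT R n) {A B : R[X]} (hBn : B.natDegree ≤ n) {b c : R}
    (hcb : c < b) (hroot : ∀ x, c ≤ x → x < b → B.eval x = 0 → B = 0)
    (hne : A.eval b ≠ 0 ∨ B.eval b ≠ 0) :
    indSide (-1) b A B = germIndex (A.eval b) (B.eval b) (B.eval c) := by
  unfold germIndex
  split_ifs with h
  · by_cases hB : B = 0
    · simp [indSide, hB]
    rw [indSide_eq (-1) hB h (hne.resolve_right (not_not.2 h))]
    have hpos := (hR.mono ((natDegree_cofactor_le b B).trans hBn)).mul_pos le_rfl hcb.le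
      (fun x hcx hxb => cofactor_eval_ne_zero hB fun hxb' h0 =>
        hB (hroot x hcx (lt_of_le_of_ne hxb hxb') h0))
    conv_rhs => rw [cofactor_spec b B]
    rw [eval_mul, sgn_mul, eval_pow, sgn_pow, eval_sub, eval_X, eval_C,
      sgn_of_neg (sub_neg.2 hcb), sgn_eq_of_mul_pos hpos]
    simp
  · exact indSide_eq_zero _ _ _ _ h

theorem cauchyIndex_swap (a b : R) (A B : R[X]) : cauchyIndex b a A B = -cauchyIndex a b A B := by
  unfold cauchyIndex
  rcases lt_trichotomy a b with h | rfl | h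
  · simp [h, h.not_gt]
    split_ifs <;> simp
  · simp
  · simp [h, h.not_gt]
    split_ifs <;> simp

theorem cauchyIndex_of_lt {a b : R} (hab : a < b) (A B : R[X]) :
    cauchyIndex a b A B = indSide 1 a A B +
      (if A = 0 then 0 else ∑ x ∈ B.roots.toFinset with a < x ∧ x < b, indAt x A B)
      - indSide (-1) b A B := by
  unfold cauchyIndex indIncreasing
  by_cases hA : A = 0
  · simp [hA, indSide]
  by_cases hB : B = 0
  · simp [hB, indSide]
  simp [hA, hB, hab]

theorem cauchyIndex_of_forall_ne {a b : R} (hab : a < b) {A B : R[X]}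
    (h : ∀ x, a < x → x < b → B.eval x = 0 → B = 0) :
    cauchyIndex a b A B = indSide 1 a A B - indSide (-1) b A B := by
  have : (B.roots.toFinset.filter fun x => a < x ∧ x < b) = ∅ := by
    refine Finset.filter_eq_empty_iff.2 fun x hx hxab => ?_
    rw [Multiset.mem_toFinset, mem_roots'] at hx
    exact hx.1 (h x hxab.1 hxab.2 hx.2)
  rw [cauchyIndex_of_lt hab, this]
  simp

/-- The one-sided indices at c contributed by the two halves add up to `indAt c`. -/
theorem cauchyIndex_add {a b c : R} (hac : a < c) (hcb : c < b) (A B : R[X]) :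
    cauchyIndex a b A B = cauchyIndex a c A B + cauchyIndex c b A B := by
  rw [cauchyIndex_of_lt (hac.trans hcb), cauchyIndex_of_lt hac, cauchyIndex_of_lt hcb]
  by_cases hA : A = 0
  · simp [hA, indSide]
  by_cases hB : B = 0
  · simp [hB, indSide]
  simp only [hA, if_false]
  have hsplit : ∑ x ∈ B.roots.toFinset with a < x ∧ x < b, indAt x A B =
      (∑ x ∈ B.roots.toFinset with a < x ∧ x < c, indAt x A B) +
      (∑ x ∈ B.roots.toFinset with c < x ∧ x < b, indAt x A B) + indAt c A B := by
    simp only [Finset.sum_filter]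
    rw [← Finset.sum_add_distrib]
    have hc : indAt c A B = ∑ x ∈ B.roots.toFinset, if x = c then indAt x A B else 0 := by
      rw [Finset.sum_ite_eq']
      split_ifs with h
      · rfl
      · refine indAt_eq_zero c A B fun hr => h ?_
        rw [Multiset.mem_toFinset, mem_roots hB]
        exact hr
    rw [hc, ← Finset.sum_add_distrib]
    refine Finset.sum_congr rfl fun x _ => ?_
    rcases lt_trichotomy x c with h | rfl | h
    · simp [h, h.not_gt, h.ne, h.trans hcb]
    · simp [hac, hcb]
    · simp [h, h.not_gt, h.ne', hac.trans h]
  rw [hsplit, indAt]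
  ring

/-- The boundary term in the product formula for the Cauchy index. -/
def boundaryDefect (A B A' B' : R[X]) (x : R) : ℚ :=
  defect (B.eval x) (B'.eval x) ((A * B' + A' * B).eval x)

/-- One interior point c serves as the nearby point for the germs at both a and b. Subtracting the
two instances of `germIndex_mul` cancels the defect at c. -/
theorem cauchyIndex_mul_of_forall_ne {n : ℕ} (hR : IVT R n) {A B A' B' : R[X]}
    (hA : A.natDegree ≤ n)
    (hB : B.natDegree ≤ n) (hA' : A'.natDegree ≤ n) (hB' : B'.natDegree ≤ n)
    (hT : (A * B' + A' * B).natDegree ≤ n) {a b : R} (hab : a < b)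
    (hne : ∀ x, a ≤ x → x ≤ b → A.eval x ≠ 0 ∨ B.eval x ≠ 0)
    (hne' : ∀ x, a ≤ x → x ≤ b → A'.eval x ≠ 0 ∨ B'.eval x ≠ 0)
    (hroot : ∀ P ∈ ({A, B, A', B', A * B' + A' * B} : Set R[X]),
      ∀ x, a < x → x < b → P.eval x = 0 → P = 0) :
    cauchyIndex a b (A * A' - B * B') (A * B' + A' * B) =
      cauchyIndex a b A B + cauchyIndex a b A' B' +
        boundaryDefect A B A' B' b - boundaryDefect A B A' B' a := by
  obtain ⟨c, hac, hcb⟩ := exists_between hab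
  set T := A * B' + A' * B with hTdef
  set S := A * A' - B * B' with hS
  have hneT : ∀ x, a ≤ x → x ≤ b → S.eval x ≠ 0 ∨ T.eval x ≠ 0 := by
    intro x hax hxb
    by_contra! h
    obtain ⟨h1, h2⟩ := h
    rw [hS, eval_sub, eval_mul, eval_mul] at h1
    rw [hTdef, eval_add, eval_mul, eval_mul] at h2
    -- Multiplicativity of the norm: S² + T² = (A² + B²)(A'² + B'²).
    have h3 : ((A.eval x) ^ 2 + (B.eval x) ^ 2) * ((A'.eval x) ^ 2 + (B'.eval x) ^ 2) = 0 := by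
      linear_combination (A.eval x * A'.eval x - B.eval x * B'.eval x) * h1 +
        (A.eval x * B'.eval x + A'.eval x * B.eval x) * h2
    rcases mul_eq_zero.1 h3 with h | h
    · have h4 := (add_eq_zero_iff_of_nonneg (sq_nonneg _) (sq_nonneg _)).1 h
      rcases hne x hax hxb with h5 | h5
      · exact h5 (pow_eq_zero_iff two_ne_zero |>.1 h4.1)
      · exact h5 (pow_eq_zero_iff two_ne_zero |>.1 h4.2)
    · have h4 := (add_eq_zero_iff_of_nonneg (sq_nonneg _) (sq_nonneg _)).1 h
      rcases hne' x hax hxb with h5 | h5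
      · exact h5 (pow_eq_zero_iff two_ne_zero |>.1 h4.1)
      · exact h5 (pow_eq_zero_iff two_ne_zero |>.1 h4.2)
  have key : ∀ P : R[X], P.natDegree ≤ n → (∀ x, a < x → x < b → P.eval x = 0 → P = 0) →
      (P.eval a ≠ 0 → sgn (P.eval c) = sgn (P.eval a)) ∧
      (P.eval b ≠ 0 → sgn (P.eval c) = sgn (P.eval b)) := by
    intro P hP hr
    refine ⟨fun h => (sgn_eq_of_mul_pos (hR.mul_pos hP hac.le fun x hax hxc h0 => ?_)).symm,
      fun h => sgn_eq_of_mul_pos (hR.mul_pos hP hcb.le fun x hcx hxb h0 => ?_)⟩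
    · rcases hax.eq_or_lt with rfl | hax
      · exact h h0
      · rw [hr x hax (hxc.trans_lt hcb) h0] at h; simp at h
    · rcases hxb.eq_or_lt with rfl | hxb
      · exact h h0
      · rw [hr x (hac.trans_le hcx) hxb h0] at h; simp at h
  have rA := hroot A (by simp)
  have rB := hroot B (by simp)
  have rA' := hroot A' (by simp)
  have rB' := hroot B' (by simp)
  have rT := hroot T (by simp)
  rw [cauchyIndex_of_forall_ne hab rT, cauchyIndex_of_forall_ne hab rB,
    cauchyIndex_of_forall_ne hab rB']
  have toC : ∀ P : R[X], (∀ x, a < x → x < b → P.eval x = 0 → P = 0) →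
      ∀ x, a < x → x ≤ c → P.eval x = 0 → P = 0 := fun P h x h1 h2 => h x h1 (h2.trans_lt hcb)
  have fromC : ∀ P : R[X], (∀ x, a < x → x < b → P.eval x = 0 → P = 0) →
      ∀ x, c ≤ x → x < b → P.eval x = 0 → P = 0 := fun P h x h1 h2 => h x (hac.trans_le h1) h2
  rw [indSide_one_eq hR hT hac (toC T rT) (hneT a le_rfl hab.le),
    indSide_one_eq hR hB hac (toC B rB) (hne a le_rfl hab.le),
    indSide_one_eq hR hB' hac (toC B' rB') (hne' a le_rfl hab.le),
    indSide_neg_one_eq hR hT hcb (fromC T rT) (hneT b hab.le le_rfl),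
    indSide_neg_one_eq hR hB hcb (fromC B rB) (hne b hab.le le_rfl),
    indSide_neg_one_eq hR hB' hcb (fromC B' rB') (hne' b hab.le le_rfl)]
  have eT : ∀ x, T.eval x = A.eval x * B'.eval x + A'.eval x * B.eval x := fun x => by
    rw [hTdef, eval_add, eval_mul, eval_mul]
  have eS : ∀ x, S.eval x = A.eval x * A'.eval x - B.eval x * B'.eval x := fun x => by
    rw [hS, eval_sub, eval_mul, eval_mul]
  have kT := key T hT rT
  have h1 := germIndex_mul (hne a le_rfl hab.le) (hne' a le_rfl hab.le) (key A hA rA).1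
    (key B hB rB).1 (key A' hA' rA').1 (key B' hB' rB').1 (by simpa only [eT] using kT.1)
  have h2 := germIndex_mul (hne b hab.le le_rfl) (hne' b hab.le le_rfl) (key A hA rA).2
    (key B hB rB).2 (key A' hA' rA').2 (key B' hB' rB').2 (by simpa only [eT] using kT.2)
  simp only [← eT, ← eS] at h1 h2
  unfold boundaryDefect
  linear_combination h1 - h2

/-- The product formula for the Cauchy index. -/
theorem cauchyIndex_mul {n : ℕ} (hR : IVT R n) {A B A' B' : R[X]} (hA : A.natDegree ≤ n)
    (hB : B.natDegree ≤ n) (hA' : A'.natDegree ≤ n) (hB' : B'.natDegree ≤ n)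
    (hT : (A * B' + A' * B).natDegree ≤ n) {a b : R} (hab : a < b)
    (hne : ∀ x, a ≤ x → x ≤ b → A.eval x ≠ 0 ∨ B.eval x ≠ 0)
    (hne' : ∀ x, a ≤ x → x ≤ b → A'.eval x ≠ 0 ∨ B'.eval x ≠ 0) :
    cauchyIndex a b (A * A' - B * B') (A * B' + A' * B) =
      cauchyIndex a b A B + cauchyIndex a b A' B' +
        boundaryDefect A B A' B' b - boundaryDefect A B A' B' a := by
  classical
  -- V collects the roots of the nonzero polynomials among the five. Splitting at one of them leaves
  -- fewer in each open half, and the boundary terms at the cut cancel.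
  set V : Finset R := (A.roots + B.roots + A'.roots + B'.roots + (A * B' + A' * B).roots).toFinset
    with hV
  induction hm : (V.filter fun x => a < x ∧ x < b).card using Nat.strong_induction_on
    generalizing a b with
  | _ m ih =>
  by_cases hemp : (V.filter fun x => a < x ∧ x < b) = ∅
  · refine cauchyIndex_mul_of_forall_ne hR hA hB hA' hB' hT hab hne hne'
      fun P hP x hax hxb h0 => ?_
    by_contra hP0
    have hx : x ∈ P.roots := (mem_roots hP0).2 h0
    have hxV : x ∈ V := by
      rw [hV, Multiset.mem_toFinset]
      simp only [Multiset.mem_add]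
      simp only [Set.mem_insert_iff, Set.mem_singleton_iff] at hP
      rcases hP with rfl | rfl | rfl | rfl | rfl <;> tauto
    exact Finset.notMem_empty x (hemp ▸ Finset.mem_filter.2 ⟨hxV, hax, hxb⟩)
  · obtain ⟨c, hc⟩ := Finset.nonempty_of_ne_empty hemp
    obtain ⟨-, hac, hcb⟩ := Finset.mem_filter.1 hc
    have hcard : ∀ a' b', a ≤ a' → b' ≤ b → (a' = c ∨ b' = c) →
        (V.filter fun x => a' < x ∧ x < b').card < m := by
      intro a' b' ha' hb' hor
      rw [← hm]
      have hsub : (V.filter fun x => a' < x ∧ x < b') ⊆ V.filter fun x => a < x ∧ x < b := by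
        intro x hx
        obtain ⟨h1, h2, h3⟩ := Finset.mem_filter.1 hx
        exact Finset.mem_filter.2 ⟨h1, ha'.trans_lt h2, h3.trans_le hb'⟩
      refine Finset.card_lt_card ((Finset.ssubset_iff_of_subset hsub).2 ⟨c, hc, fun hx => ?_⟩)
      obtain ⟨-, h2, h3⟩ := Finset.mem_filter.1 hx
      rcases hor with rfl | rfl
      · exact lt_irrefl _ h2
      · exact lt_irrefl _ h3
    have h1 := ih _ (hcard a c le_rfl hcb.le (Or.inr rfl)) hac
      (fun x h h' => hne x h (h'.trans hcb.le)) (fun x h h' => hne' x h (h'.trans hcb.le)) rfl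
    have h2 := ih _ (hcard c b hac.le le_rfl (Or.inl rfl)) hcb
      (fun x h h' => hne x (hac.le.trans h) h') (fun x h h' => hne' x (hac.le.trans h) h') rfl
    rw [cauchyIndex_add hac hcb, h1, h2, cauchyIndex_add hac hcb A B,
      cauchyIndex_add hac hcb A' B']
    ring

end Index

/-! ### Real and imaginary parts, and restriction to lines -/

section Parts

variable {R : Type*} [Field R]

theorem coeff_rePart (F : MvPolynomial (Fin 2) (Cpx R)) (m : Fin 2 →₀ ℕ) :
    (rePart F).coeff m = (F.coeff m).re := by
  classical
  unfold rePart
  rw [MvPolynomial.coeff_sum]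
  simp only [MvPolynomial.coeff_monomial]
  rw [Finset.sum_ite_eq']
  split_ifs with h
  · rfl
  · rw [MvPolynomial.notMem_support_iff.1 h]; rfl

theorem coeff_imPart (F : MvPolynomial (Fin 2) (Cpx R)) (m : Fin 2 →₀ ℕ) :
    (imPart F).coeff m = (F.coeff m).im := by
  classical
  unfold imPart
  rw [MvPolynomial.coeff_sum]
  simp only [MvPolynomial.coeff_monomial]
  rw [Finset.sum_ite_eq']
  split_ifs with h
  · rfl
  · rw [MvPolynomial.notMem_support_iff.1 h]; rfl

/-- The polynomial `A + i B` in `R[i][X, Y]`. -/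
def ofParts (A B : MvPolynomial (Fin 2) R) : MvPolynomial (Fin 2) (Cpx R) :=
  MvPolynomial.map (algebraMap R (Cpx R)) A +
    MvPolynomial.C QuadraticAlgebra.omega * MvPolynomial.map (algebraMap R (Cpx R)) B

@[simp] theorem rePart_ofParts (A B : MvPolynomial (Fin 2) R) : rePart (ofParts A B) = A := by
  ext m
  rw [coeff_rePart, ofParts, MvPolynomial.coeff_add, MvPolynomial.coeff_C_mul,
    MvPolynomial.coeff_map, MvPolynomial.coeff_map]
  simp

@[simp] theorem imPart_ofParts (A B : MvPolynomial (Fin 2) R) : imPart (ofParts A B) = B := by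
  ext m
  rw [coeff_imPart, ofParts, MvPolynomial.coeff_add, MvPolynomial.coeff_C_mul,
    MvPolynomial.coeff_map, MvPolynomial.coeff_map]
  simp

theorem ofParts_rePart_imPart (F : MvPolynomial (Fin 2) (Cpx R)) :
    ofParts (rePart F) (imPart F) = F := by
  refine MvPolynomial.ext _ _ fun m => ?_
  rw [ofParts, MvPolynomial.coeff_add, MvPolynomial.coeff_C_mul,
    MvPolynomial.coeff_map, MvPolynomial.coeff_map, coeff_rePart, coeff_imPart]
  ext <;> simp

theorem omega_mul_omega : (QuadraticAlgebra.omega : Cpx R) * QuadraticAlgebra.omega = -1 := by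
  ext <;> simp [QuadraticAlgebra.re_one, QuadraticAlgebra.im_one]

theorem ofParts_mul (A B A' B' : MvPolynomial (Fin 2) R) :
    ofParts A B * ofParts A' B' = ofParts (A * A' - B * B') (A * B' + A' * B) := by
  have h : (MvPolynomial.C (QuadraticAlgebra.omega : Cpx R) : MvPolynomial (Fin 2) (Cpx R)) *
      MvPolynomial.C QuadraticAlgebra.omega = -1 := by
    rw [← map_mul, omega_mul_omega, map_neg, map_one]
  unfold ofParts
  simp only [map_add, map_sub, map_mul]
  linear_combination (MvPolynomial.map (algebraMap R (Cpx R)) B *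
    MvPolynomial.map (algebraMap R (Cpx R)) B') * h

theorem rePart_mul (F G : MvPolynomial (Fin 2) (Cpx R)) :
    rePart (F * G) = rePart F * rePart G - imPart F * imPart G := by
  conv_lhs => rw [← ofParts_rePart_imPart F, ← ofParts_rePart_imPart G, ofParts_mul]
  exact rePart_ofParts _ _

theorem imPart_mul (F G : MvPolynomial (Fin 2) (Cpx R)) :
    imPart (F * G) = rePart F * imPart G + rePart G * imPart F := by
  conv_lhs => rw [← ofParts_rePart_imPart F, ← ofParts_rePart_imPart G, ofParts_mul]
  exact imPart_ofParts _ _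

theorem toBivariate_mul (F G : (Cpx R)[X]) :
    toBivariate (F * G) = toBivariate F * toBivariate G := map_mul _ _ _

theorem eval_toBivariate (F : (Cpx R)[X]) (x y : R) :
    MvPolynomial.eval ![algebraMap R (Cpx R) x, algebraMap R (Cpx R) y] (toBivariate F) =
      F.eval ⟨x, y⟩ := by
  unfold toBivariate
  rw [aeval_def, hom_eval₂]
  have h1 : (MvPolynomial.eval ![algebraMap R (Cpx R) x, algebraMap R (Cpx R) y]).comp
      (algebraMap (Cpx R) (MvPolynomial (Fin 2) (Cpx R))) = RingHom.id _ := by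
    ext z <;> simp [MvPolynomial.algebraMap_eq]
  rw [h1, eval₂_id]
  congr 1
  ext <;> simp

theorem eval_ofParts (A B : MvPolynomial (Fin 2) R) (x y : R) :
    MvPolynomial.eval ![algebraMap R (Cpx R) x, algebraMap R (Cpx R) y] (ofParts A B) =
      ⟨MvPolynomial.eval ![x, y] A, MvPolynomial.eval ![x, y] B⟩ := by
  have h : ∀ P : MvPolynomial (Fin 2) R,
      MvPolynomial.eval ![algebraMap R (Cpx R) x, algebraMap R (Cpx R) y]
        (MvPolynomial.map (algebraMap R (Cpx R)) P) =
      algebraMap R (Cpx R) (MvPolynomial.eval ![x, y] P) := by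
    intro P
    rw [MvPolynomial.eval_map, ← MvPolynomial.eval₂_id, MvPolynomial.hom_eval₂]
    congr 1
    funext i
    fin_cases i <;> rfl
  unfold ofParts
  rw [map_add, map_mul, h, h, MvPolynomial.eval_C]
  ext <;> simp

theorem eval_parts (F : (Cpx R)[X]) (x y : R) :
    MvPolynomial.eval ![x, y] (rePart (toBivariate F)) = (F.eval ⟨x, y⟩).re ∧
      MvPolynomial.eval ![x, y] (imPart (toBivariate F)) = (F.eval ⟨x, y⟩).im := by
  have h := eval_ofParts (rePart (toBivariate F)) (imPart (toBivariate F)) x y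
  rw [ofParts_rePart_imPart, eval_toBivariate] at h
  rw [h]
  exact ⟨rfl, rfl⟩

theorem eval_alongX (P : MvPolynomial (Fin 2) R) (x y : R) :
    (alongX y P).eval x = MvPolynomial.eval ![x, y] P := by
  have h := MvPolynomial.comp_aeval_apply ![X, C y] (aeval x : R[X] →ₐ[R] R) P
  rw [← coe_aeval_eq_eval]
  change aeval x (MvPolynomial.aeval ![X, C y] P) = _
  rw [h, ← MvPolynomial.coe_aeval_eq_eval]
  change _ = MvPolynomial.aeval ![x, y] P
  congr 2
  ext i
  fin_cases i <;> simp

theorem eval_alongY (P : MvPolynomial (Fin 2) R) (x y : R) :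
    (alongY x P).eval y = MvPolynomial.eval ![x, y] P := by
  have h := MvPolynomial.comp_aeval_apply ![C x, X] (aeval y : R[X] →ₐ[R] R) P
  rw [← coe_aeval_eq_eval]
  change aeval y (MvPolynomial.aeval ![C x, X] P) = _
  rw [h, ← MvPolynomial.coe_aeval_eq_eval]
  change _ = MvPolynomial.aeval ![x, y] P
  congr 2
  ext i
  fin_cases i <;> simp

/-- X + iY has total degree at most 1. This keeps every restriction to a side within degree deg F,
as the product formula requires. -/
theorem totalDegree_toBivariate_le (F : (Cpx R)[X]) :
    (toBivariate F).totalDegree ≤ F.natDegree := by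
  unfold toBivariate
  rw [aeval_eq_sum_range]
  refine MvPolynomial.totalDegree_finsetSum_le fun i hi => ?_
  refine (MvPolynomial.totalDegree_smul_le _ _).trans ((MvPolynomial.totalDegree_pow _ _).trans ?_)
  have h1 : (MvPolynomial.X 0 + MvPolynomial.C (QuadraticAlgebra.omega : Cpx R) *
      MvPolynomial.X 1 : MvPolynomial (Fin 2) (Cpx R)).totalDegree ≤ 1 := by
    refine (MvPolynomial.totalDegree_add _ _).trans (max_le (MvPolynomial.totalDegree_X _).le ?_)
    refine (MvPolynomial.totalDegree_mul _ _).trans ?_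
    rw [MvPolynomial.totalDegree_C, zero_add]
    exact (MvPolynomial.totalDegree_X _).le
  calc _ ≤ i * 1 := Nat.mul_le_mul_left i h1
    _ ≤ _ := by have := Finset.mem_range.1 hi; omega

theorem totalDegree_rePart_le (F : MvPolynomial (Fin 2) (Cpx R)) :
    (rePart F).totalDegree ≤ F.totalDegree :=
  MvPolynomial.totalDegree_finsetSum_le fun _ hm =>
    (MvPolynomial.totalDegree_monomial_le _ _).trans (MvPolynomial.le_totalDegree hm)

theorem totalDegree_imPart_le (F : MvPolynomial (Fin 2) (Cpx R)) :
    (imPart F).totalDegree ≤ F.totalDegree :=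
  MvPolynomial.totalDegree_finsetSum_le fun _ hm =>
    (MvPolynomial.totalDegree_monomial_le _ _).trans (MvPolynomial.le_totalDegree hm)

theorem natDegree_alongX_le (P : MvPolynomial (Fin 2) R) (y : R) :
    (alongX y P).natDegree ≤ P.totalDegree := by
  have := MvPolynomial.aeval_natDegree_le (n := 1) P le_rfl ![X, C y] (by
    intro i; fin_cases i <;> simp)
  rwa [mul_one] at this

theorem natDegree_alongY_le (P : MvPolynomial (Fin 2) R) (x : R) :
    (alongY x P).natDegree ≤ P.totalDegree := by
  have := MvPolynomial.aeval_natDegree_le (n := 1) P le_rfl ![C x, X] (by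
    intro i; fin_cases i <;> simp)
  rwa [mul_one] at this

theorem natDegree_alongX_parts_le (F : (Cpx R)[X]) (y : R) :
    (alongX y (rePart (toBivariate F))).natDegree ≤ F.natDegree ∧
      (alongX y (imPart (toBivariate F))).natDegree ≤ F.natDegree :=
  ⟨(natDegree_alongX_le _ _).trans
    ((totalDegree_rePart_le _).trans (totalDegree_toBivariate_le F)),
  (natDegree_alongX_le _ _).trans
    ((totalDegree_imPart_le _).trans (totalDegree_toBivariate_le F))⟩

theorem natDegree_alongY_parts_le (F : (Cpx R)[X]) (x : R) :
    (alongY x (rePart (toBivariate F))).natDegree ≤ F.natDegree ∧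
      (alongY x (imPart (toBivariate F))).natDegree ≤ F.natDegree :=
  ⟨(natDegree_alongY_le _ _).trans
    ((totalDegree_rePart_le _).trans (totalDegree_toBivariate_le F)),
  (natDegree_alongY_le _ _).trans
    ((totalDegree_imPart_le _).trans (totalDegree_toBivariate_le F))⟩

end Parts

/-! ### Additivity of the winding number -/

section Multiplicativity

variable {R : Type*} [Field R] [LinearOrder R] [IsStrictOrderedRing R]

/-- The boundary term of the product formula at the point `z`. -/
def cornerDefect (F G : (Cpx R)[X]) (z : Cpx R) : ℚ :=
  defect (F.eval z).im (G.eval z).im ((F * G).eval z).im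

theorem re_ne_zero_or_im_ne_zero {z : Cpx R} (h : z ≠ 0) : z.re ≠ 0 ∨ z.im ≠ 0 := by
  by_contra! h'
  exact h (QuadraticAlgebra.ext h'.1 h'.2)

/-- The boundary terms become values of one function of the corner, the same for horizontal and
vertical sides, so that they can cancel. -/
theorem cauchyIndex_alongX_mul {n : ℕ} (hR : IVT R n) {F G : (Cpx R)[X]} (hF : F.natDegree ≤ n)
    (hG : G.natDegree ≤ n) (hFG : (F * G).natDegree ≤ n) {a b y : R} (hab : a < b)
    (hF0 : ∀ x, a ≤ x → x ≤ b → F.eval ⟨x, y⟩ ≠ 0) (hG0 : ∀ x, a ≤ x → x ≤ b → G.eval ⟨x, y⟩ ≠ 0) :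
    cauchyIndex a b (alongX y (rePart (toBivariate (F * G))))
        (alongX y (imPart (toBivariate (F * G)))) =
      cauchyIndex a b (alongX y (rePart (toBivariate F))) (alongX y (imPart (toBivariate F))) +
      cauchyIndex a b (alongX y (rePart (toBivariate G))) (alongX y (imPart (toBivariate G))) +
      cornerDefect F G ⟨b, y⟩ - cornerDefect F G ⟨a, y⟩ := by
  have eS : alongX y (rePart (toBivariate (F * G))) =
      alongX y (rePart (toBivariate F)) * alongX y (rePart (toBivariate G)) -
      alongX y (imPart (toBivariate F)) * alongX y (imPart (toBivariate G)) := by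
    rw [toBivariate_mul, rePart_mul]; simp only [alongX, map_sub, map_mul]
  have eT : alongX y (imPart (toBivariate (F * G))) =
      alongX y (rePart (toBivariate F)) * alongX y (imPart (toBivariate G)) +
      alongX y (rePart (toBivariate G)) * alongX y (imPart (toBivariate F)) := by
    rw [toBivariate_mul, imPart_mul]; simp only [alongX, map_add, map_mul]
  have hev : ∀ (H : (Cpx R)[X]) (x : R), (alongX y (rePart (toBivariate H))).eval x =
      (H.eval ⟨x, y⟩).re := fun H x => by rw [eval_alongX, (eval_parts H x y).1]
  have hev' : ∀ (H : (Cpx R)[X]) (x : R), (alongX y (imPart (toBivariate H))).eval x =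
      (H.eval ⟨x, y⟩).im := fun H x => by rw [eval_alongX, (eval_parts H x y).2]
  have hdF := natDegree_alongX_parts_le F y
  have hdG := natDegree_alongX_parts_le G y
  have hdFG := natDegree_alongX_parts_le (F * G) y
  have h := cauchyIndex_mul hR (hdF.1.trans hF) (hdF.2.trans hF) (hdG.1.trans hG) (hdG.2.trans hG)
    (eT ▸ hdFG.2.trans hFG) hab
    (fun x h1 h2 => by rw [hev, hev']; exact re_ne_zero_or_im_ne_zero (hF0 x h1 h2))
    (fun x h1 h2 => by rw [hev, hev']; exact re_ne_zero_or_im_ne_zero (hG0 x h1 h2))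
  unfold boundaryDefect at h
  unfold cornerDefect
  rw [← eS, ← eT] at h
  simpa only [hev'] using h

theorem cauchyIndex_alongY_mul {n : ℕ} (hR : IVT R n) {F G : (Cpx R)[X]} (hF : F.natDegree ≤ n)
    (hG : G.natDegree ≤ n) (hFG : (F * G).natDegree ≤ n) {a b x : R} (hab : a < b)
    (hF0 : ∀ y, a ≤ y → y ≤ b → F.eval ⟨x, y⟩ ≠ 0) (hG0 : ∀ y, a ≤ y → y ≤ b → G.eval ⟨x, y⟩ ≠ 0) :
    cauchyIndex a b (alongY x (rePart (toBivariate (F * G))))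
        (alongY x (imPart (toBivariate (F * G)))) =
      cauchyIndex a b (alongY x (rePart (toBivariate F))) (alongY x (imPart (toBivariate F))) +
      cauchyIndex a b (alongY x (rePart (toBivariate G))) (alongY x (imPart (toBivariate G))) +
      cornerDefect F G ⟨x, b⟩ - cornerDefect F G ⟨x, a⟩ := by
  have eS : alongY x (rePart (toBivariate (F * G))) =
      alongY x (rePart (toBivariate F)) * alongY x (rePart (toBivariate G)) -
      alongY x (imPart (toBivariate F)) * alongY x (imPart (toBivariate G)) := by
    rw [toBivariate_mul, rePart_mul]; simp only [alongY, map_sub, map_mul]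
  have eT : alongY x (imPart (toBivariate (F * G))) =
      alongY x (rePart (toBivariate F)) * alongY x (imPart (toBivariate G)) +
      alongY x (rePart (toBivariate G)) * alongY x (imPart (toBivariate F)) := by
    rw [toBivariate_mul, imPart_mul]; simp only [alongY, map_add, map_mul]
  have hev : ∀ (H : (Cpx R)[X]) (y : R), (alongY x (rePart (toBivariate H))).eval y =
      (H.eval ⟨x, y⟩).re := fun H y => by rw [eval_alongY, (eval_parts H x y).1]
  have hev' : ∀ (H : (Cpx R)[X]) (y : R), (alongY x (imPart (toBivariate H))).eval y =
      (H.eval ⟨x, y⟩).im := fun H y => by rw [eval_alongY, (eval_parts H x y).2]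
  have hdF := natDegree_alongY_parts_le F x
  have hdG := natDegree_alongY_parts_le G x
  have hdFG := natDegree_alongY_parts_le (F * G) x
  have h := cauchyIndex_mul hR (hdF.1.trans hF) (hdF.2.trans hF) (hdG.1.trans hG) (hdG.2.trans hG)
    (eT ▸ hdFG.2.trans hFG) hab
    (fun y h1 h2 => by rw [hev, hev']; exact re_ne_zero_or_im_ne_zero (hF0 y h1 h2))
    (fun y h1 h2 => by rw [hev, hev']; exact re_ne_zero_or_im_ne_zero (hG0 y h1 h2))
  unfold boundaryDefect at h
  unfold cornerDefect
  rw [← eS, ← eT] at h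
  simpa only [hev'] using h

/-- The winding number is additive on products. -/
theorem windingNumber_mul {n : ℕ} (hR : IVT R n) {F G : (Cpx R)[X]} (hF : F.natDegree ≤ n)
    (hG : G.natDegree ≤ n) (hFG : (F * G).natDegree ≤ n) {x₀ x₁ y₀ y₁ : R} (hx : x₀ < x₁)
    (hy : y₀ < y₁) (hF0 : ∀ z ∈ rectBoundary x₀ x₁ y₀ y₁, F.eval z ≠ 0)
    (hG0 : ∀ z ∈ rectBoundary x₀ x₁ y₀ y₁, G.eval z ≠ 0) :
    windingNumber (F * G) x₀ x₁ y₀ y₁ =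
      windingNumber F x₀ x₁ y₀ y₁ + windingNumber G x₀ x₁ y₀ y₁ := by
  have b1 : ∀ x, x₀ ≤ x → x ≤ x₁ → (⟨x, y₀⟩ : Cpx R) ∈ rectBoundary x₀ x₁ y₀ y₁ :=
    fun x h h' => Or.inl ⟨h, h', Or.inl rfl⟩
  have b2 : ∀ x, x₀ ≤ x → x ≤ x₁ → (⟨x, y₁⟩ : Cpx R) ∈ rectBoundary x₀ x₁ y₀ y₁ :=
    fun x h h' => Or.inl ⟨h, h', Or.inr rfl⟩
  have b3 : ∀ y, y₀ ≤ y → y ≤ y₁ → (⟨x₀, y⟩ : Cpx R) ∈ rectBoundary x₀ x₁ y₀ y₁ :=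
    fun y h h' => Or.inr ⟨h, h', Or.inl rfl⟩
  have b4 : ∀ y, y₀ ≤ y → y ≤ y₁ → (⟨x₁, y⟩ : Cpx R) ∈ rectBoundary x₀ x₁ y₀ y₁ :=
    fun y h h' => Or.inr ⟨h, h', Or.inr rfl⟩
  unfold windingNumber windingNumber₂
  simp only [cauchyIndex_swap x₀ x₁, cauchyIndex_swap y₀ y₁]
  rw [cauchyIndex_alongX_mul hR hF hG hFG hx (fun x h h' => hF0 _ (b1 x h h'))
      (fun x h h' => hG0 _ (b1 x h h')),
    cauchyIndex_alongX_mul hR hF hG hFG hx (fun x h h' => hF0 _ (b2 x h h'))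
      (fun x h h' => hG0 _ (b2 x h h')),
    cauchyIndex_alongY_mul hR hF hG hFG hy (fun x h h' => hF0 _ (b3 x h h'))
      (fun x h h' => hG0 _ (b3 x h h')),
    cauchyIndex_alongY_mul hR hF hG hFG hy (fun x h h' => hF0 _ (b4 x h h'))
      (fun x h h' => hG0 _ (b4 x h h'))]
  -- Each corner defect occurs twice, with opposite signs.
  ring

end Multiplicativity

/-! ### Constants and linear polynomials -/

section Linear

variable {R : Type*} [Field R] [LinearOrder R] [IsStrictOrderedRing R]

theorem indSide_C (ε : ℤˣ) (x : R) (A : R[X]) (c : R) : indSide ε x A (C c) = 0 := by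
  by_cases hc : c = 0
  · simp [indSide, hc]
  · exact indSide_eq_zero _ _ _ _ (by simpa)

theorem cauchyIndex_C (a b : R) (A : R[X]) (c : R) : cauchyIndex a b A (C c) = 0 := by
  have key : ∀ a b : R, a < b → cauchyIndex a b A (C c) = 0 := fun a b hab => by
    rw [cauchyIndex_of_forall_ne hab (fun x _ _ h => by rw [eval_C] at h; rw [h, C_0]),
      indSide_C, indSide_C, sub_zero]
  rcases lt_trichotomy a b with h | rfl | h
  · exact key a b h
  · simp [cauchyIndex]
  · rw [cauchyIndex_swap, key b a h, neg_zero]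

theorem windingNumber_C (c : Cpx R) (x₀ x₁ y₀ y₁ : R) : windingNumber (C c) x₀ x₁ y₀ y₁ = 0 := by
  have hX : ∀ y, ∃ r : R, alongX y (imPart (toBivariate (C c))) = C r := fun y =>
    ⟨_, eq_C_of_natDegree_eq_zero
      (Nat.le_zero.1 ((natDegree_alongX_parts_le (C c) y).2.trans (natDegree_C c).le))⟩
  have hY : ∀ x, ∃ r : R, alongY x (imPart (toBivariate (C c))) = C r := fun x =>
    ⟨_, eq_C_of_natDegree_eq_zero
      (Nat.le_zero.1 ((natDegree_alongY_parts_le (C c) x).2.trans (natDegree_C c).le))⟩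
  obtain ⟨r1, h1⟩ := hX y₀
  obtain ⟨r2, h2⟩ := hX y₁
  obtain ⟨r3, h3⟩ := hY x₀
  obtain ⟨r4, h4⟩ := hY x₁
  unfold windingNumber windingNumber₂
  rw [h1, h2, h3, h4]
  simp only [cauchyIndex_C]
  norm_num

theorem indSide_C_X_sub_C (ε : ℤˣ) (x u b : R) :
    indSide ε x (C u) (X - C b) = if x = b then 1 / 2 * sgn u * ((ε : ℤ) : ℚ) else 0 := by
  split_ifs with h
  · subst h
    by_cases hu : u = 0
    · simp [hu, indSide]
    rw [indSide_eq ε (X_sub_C_ne_zero x) (by simp) (by simpa)]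
    have : (X - C x : R[X]) /ₘ (X - C x) = 1 := by
      have := mul_divByMonic_cancel_left (1 : R[X]) (monic_X_sub_C x)
      rwa [mul_one] at this
    rw [cofactor, rootMultiplicity_X_sub_C_self, pow_one, pow_one, this, eval_one, eval_C,
      sgn_of_pos one_pos, mul_one]
  · exact indSide_eq_zero _ _ _ _ (by simpa [sub_eq_zero] using h)

theorem cauchyIndex_C_X_sub_C {a c : R} (hac : a < c) (u b : R) :
    cauchyIndex a c (C u) (X - C b) = sgn u * ((if a = b then 1 / 2 else 0) +
      (if a < b ∧ b < c then 1 else 0) + (if c = b then 1 / 2 else 0)) := by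
  by_cases hu : u = 0
  · simp [hu, cauchyIndex]
  have hs : ∑ x ∈ (X - C b).roots.toFinset with a < x ∧ x < c, indAt x (C u) (X - C b) =
      if a < b ∧ b < c then sgn u else 0 := by
    rw [roots_X_sub_C, Multiset.toFinset_singleton, Finset.sum_filter, Finset.sum_singleton]
    split_ifs
    · rw [indAt, indSide_C_X_sub_C, indSide_C_X_sub_C, if_pos rfl, if_pos rfl]
      norm_num
      ring
    · rfl
  rw [cauchyIndex_of_lt hac, if_neg (C_ne_zero.2 hu), hs, indSide_C_X_sub_C, indSide_C_X_sub_C]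
  split_ifs <;> norm_num <;> ring

theorem toBivariate_X_sub_C (z : Cpx R) :
    toBivariate (X - C z) = ofParts (MvPolynomial.X 0 - MvPolynomial.C z.re)
      (MvPolynomial.X 1 - MvPolynomial.C z.im) := by
  have hz : (MvPolynomial.C z : MvPolynomial (Fin 2) (Cpx R)) =
      MvPolynomial.C (algebraMap R (Cpx R) z.re) +
        MvPolynomial.C QuadraticAlgebra.omega * MvPolynomial.C (algebraMap R (Cpx R) z.im) := by
    rw [← map_mul, ← map_add]
    congr 1
    ext <;> simp
  unfold toBivariate ofParts
  rw [map_sub, aeval_X, aeval_C, MvPolynomial.algebraMap_eq, hz]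
  simp only [map_sub, MvPolynomial.map_X, MvPolynomial.map_C]
  ring

/-- The winding number of a linear polynomial. -/
theorem windingNumber_X_sub_C {x₀ x₁ y₀ y₁ : R} (hx : x₀ < x₁) (hy : y₀ < y₁) {z : Cpx R}
    (hz : z ∉ rectBoundary x₀ x₁ y₀ y₁) [Decidable (z ∈ rectInterior x₀ x₁ y₀ y₁)] :
    windingNumber (X - C z) x₀ x₁ y₀ y₁ = if z ∈ rectInterior x₀ x₁ y₀ y₁ then 1 else 0 := by
  have hX : ∀ y, alongX y (MvPolynomial.X 1 - MvPolynomial.C z.im) = C (y - z.im) := fun y => by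
    simp [alongX]
  have hY : ∀ x, alongY x (MvPolynomial.X 1 - MvPolynomial.C z.im) = X - C z.im := fun x => by
    simp [alongY]
  have hY' : ∀ x, alongY x (MvPolynomial.X 0 - MvPolynomial.C z.re) = C (x - z.re) := fun x => by
    simp [alongY]
  unfold windingNumber windingNumber₂
  rw [toBivariate_X_sub_C, rePart_ofParts, imPart_ofParts]
  -- On horizontal sides the imaginary part is constant, so only the vertical sides contribute.
  -- Endpoint halves can arise only for z left or right of Γ, where the two sides cancel.
  simp only [cauchyIndex_swap y₀ y₁, hX, hY, hY', cauchyIndex_C, cauchyIndex_C_X_sub_C hy]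
  have hin : z ∈ rectInterior x₀ x₁ y₀ y₁ ↔ x₀ < z.re ∧ z.re < x₁ ∧ y₀ < z.im ∧ z.im < y₁ := Iff.rfl
  simp only [rectBoundary, Set.mem_ofPred_eq, not_or, not_and] at hz
  obtain ⟨hz1, hz2⟩ := hz
  rcases lt_trichotomy z.re x₀ with h0 | h0 | h0
  · have e : z ∉ rectInterior x₀ x₁ y₀ y₁ := fun h => absurd (hin.1 h).1 h0.not_gt
    rw [sgn_of_pos (sub_pos.2 h0), sgn_of_pos (sub_pos.2 (h0.trans hx)), if_neg e]
    ring
  · have hy0 : y₀ ≤ z.im → ¬ z.im ≤ y₁ := fun h h' => (hz2 h h').1 h0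
    have e1 : ¬ y₀ = z.im := fun h => hy0 h.le (h ▸ hy.le)
    have e2 : ¬ y₁ = z.im := fun h => hy0 (h ▸ hy.le) h.ge
    have e3 : ¬ (y₀ < z.im ∧ z.im < y₁) := fun h => hy0 h.1.le h.2.le
    have e : z ∉ rectInterior x₀ x₁ y₀ y₁ := fun h => absurd (hin.1 h).1 h0.le.not_gt
    rw [if_neg e1, if_neg e2, if_neg e3, if_neg e]
    ring
  rcases lt_trichotomy z.re x₁ with h1 | h1 | h1
  · have e1 : ¬ y₀ = z.im := fun h => (hz1 h0.le h1.le).1 h.symm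
    have e2 : ¬ y₁ = z.im := fun h => (hz1 h0.le h1.le).2 h.symm
    rw [sgn_of_neg (sub_neg.2 h0), sgn_of_pos (sub_pos.2 h1), if_neg e1, if_neg e2]
    simp only [hin, h0, h1, true_and]
    split_ifs <;> norm_num
  · have hy0 : y₀ ≤ z.im → ¬ z.im ≤ y₁ := fun h h' => (hz2 h h').2 h1
    have e1 : ¬ y₀ = z.im := fun h => hy0 h.le (h ▸ hy.le)
    have e2 : ¬ y₁ = z.im := fun h => hy0 (h ▸ hy.le) h.ge
    have e3 : ¬ (y₀ < z.im ∧ z.im < y₁) := fun h => hy0 h.1.le h.2.le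
    have e : z ∉ rectInterior x₀ x₁ y₀ y₁ := fun h => absurd (hin.1 h).2.1 h1.ge.not_gt
    rw [if_neg e1, if_neg e2, if_neg e3, if_neg e]
    ring
  · have e : z ∉ rectInterior x₀ x₁ y₀ y₁ := fun h => absurd (hin.1 h).2.1 h1.not_gt
    rw [sgn_of_neg (sub_neg.2 h0), sgn_of_neg (sub_neg.2 h1), if_neg e]
    ring

theorem zeroCount_X_sub_C_mul {F : (Cpx R)[X]} (hF : F ≠ 0) (z : Cpx R) (S : Set (Cpx R))
    [Decidable (z ∈ S)] :
    zeroCount ((X - C z) * F) S = (if z ∈ S then 1 else 0) + zeroCount F S := by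
  unfold zeroCount
  rw [roots_mul (mul_ne_zero (X_sub_C_ne_zero z) hF), roots_X_sub_C, Multiset.filter_add,
    Multiset.card_add]
  congr 1
  rw [Multiset.filter_singleton]
  split_ifs <;> simp

end Linear

end WindingCount

end

/-! ### Induction on the degree -/

theorem theorem3p9 {R : Type*} [Field R] [LinearOrder R] [IsStrictOrderedRing R]
    (d : ℕ) (hd : 1 ≤ d) (hIVT : WindingCount.IVT R (d ^ 2))
    (F : Polynomial (WindingCount.Cpx R)) (hF : F.natDegree ≤ d)
    (x₀ x₁ y₀ y₁ : R) (hx : x₀ < x₁) (hy : y₀ < y₁)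
    (hbd : ∀ z ∈ WindingCount.rectBoundary x₀ x₁ y₀ y₁, F.eval z ≠ 0) :
    WindingCount.windingNumber F x₀ x₁ y₀ y₁ =
      (WindingCount.zeroCount F (WindingCount.rectInterior x₀ x₁ y₀ y₁) : ℚ) := by
  classical
  have hIVTd : WindingCount.IVT R d := hIVT.mono (Nat.le_self_pow two_ne_zero d)
  induction hn : F.natDegree generalizing F with
  | zero =>
    rw [Polynomial.eq_C_of_natDegree_eq_zero hn, WindingCount.windingNumber_C,
      WindingCount.zeroCount, Polynomial.roots_C]
    simp
  | succ n ih =>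
    -- The sole use of degree d²; the rest runs on `hIVTd`.
    obtain ⟨z, hz⟩ := hIVT.exists_eval_eq_zero (by omega) hF
    obtain ⟨G, rfl⟩ := Polynomial.dvd_iff_isRoot.2 hz
    have hG : G ≠ 0 := by rintro rfl; simp at hn
    rw [Polynomial.natDegree_mul (Polynomial.X_sub_C_ne_zero z) hG,
      Polynomial.natDegree_X_sub_C] at hn
    have hbd1 : ∀ w ∈ WindingCount.rectBoundary x₀ x₁ y₀ y₁,
        (Polynomial.X - Polynomial.C z).eval w ≠ 0 := fun w hw h0 => hbd w hw (by
      rw [Polynomial.eval_mul, h0, zero_mul])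
    have hbd2 : ∀ w ∈ WindingCount.rectBoundary x₀ x₁ y₀ y₁, G.eval w ≠ 0 := fun w hw h0 =>
      hbd w hw (by rw [Polynomial.eval_mul, h0, mul_zero])
    have hGd : G.natDegree = n := by omega
    have hFd := hF
    rw [Polynomial.natDegree_mul (Polynomial.X_sub_C_ne_zero z) hG,
      Polynomial.natDegree_X_sub_C] at hFd
    rw [WindingCount.windingNumber_mul hIVTd (by rwa [Polynomial.natDegree_X_sub_C]) (by omega) hF
        hx hy hbd1 hbd2, WindingCount.zeroCount_X_sub_C_mul hG,
      WindingCount.windingNumber_X_sub_C hx hy fun hmem => hbd1 z hmem (by simp),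
      ih G (by omega) hbd2 hGd]
    push_cast
    rfl
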